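/- Let $n\ge 1$, let $0<\beta\le 1$ and $c>0$, let $D\subset\mathbb{R}^n$ be a domain (a non-empty connected open set) and let $z\in D$. Let $\tau_D=\inf\{t\ge 0: B_t\notin D\}$ (with $\inf\emptyset=\infty$) be the first exit time from $D$ of a standard $n$-dimensional Brownian motion $B$, let $P_z$ denote the probability under which $B$ starts at $z$, and suppose that $$\lim_{t\to\infty}t^{-\beta}\log P_z[\tau_D>t]=-c .$$ Let $X^+,X^-$ be $n$-dimensional standard Brownian motions and $Y$ a one-dimensional standard Brownian motion, all started at $0$, the three being independent. Put $X_t=X^+_t$ for $t\ge 0$ and $X_t=X^-_{-t}$ for $t<0$, let $Z_t=z+X_{Y_t}$ $(t\ge 0)$ be the iterated Brownian motion started at $z$, and let $\tau_D(Z)=\inf\{t\ge 0: Z_t\notin D\}$ be its first exit time from $D$. Then $$\lim_{t\to\infty}t^{-\beta/(2+\beta)}\log P[\tau_D(Z)>t]=-\Big(\frac{2+\beta}{2}\Big)\,c^{2/(2+\beta)}\,\beta^{-\beta/(2+\beta)}\,\pi^{2\beta/(2+\beta)} .$$ -/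

import Mathlib

open MeasureTheory ProbabilityTheory Filter Topology
open scoped NNReal

noncomputable section

namespace IteratedBM

/-- `B` is a standard `n`-dimensional Brownian motion started at the origin: its coordinates are
independent standard one-dimensional Brownian motions. The independence is that of processes,
each coordinate being viewed as a random path in `ℝ≥0 → ℝ`. -/
structure IsBrownian {Ω : Type*} [MeasurableSpace Ω] {n : ℕ}
    (B : ℝ≥0 → Ω → EuclideanSpace ℝ (Fin n)) (P : Measure Ω) : Prop where
  coord : ∀ i : Fin n, IsBrownianReal (fun t ω => B t ω i) P
  indep : iIndepFun (fun (i : Fin n) (ω : Ω) (t : ℝ≥0) => B t ω i) P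

/-- The two-sided process `X` with `X t = Xp t` for `t ≥ 0` and `X t = Xm (-t)` for `t < 0`. -/
def twoSided {Ω E : Type*} (Xp Xm : ℝ≥0 → Ω → E) (t : ℝ) (ω : Ω) : E :=
  if 0 ≤ t then Xp t.toNNReal ω else Xm (-t).toNNReal ω

/-- The process `Z t = z + X (Y t)`, where `X` is the two-sided process made of `Xp` and `Xm`. When
`Xp`, `Xm`, `Y` are independent Brownian motions, this is iterated Brownian motion started
at `z`. -/
def iterated {Ω E : Type*} [Add E] (z : E) (Xp Xm : ℝ≥0 → Ω → E) (Y : ℝ≥0 → Ω → ℝ)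
    (t : ℝ≥0) (ω : Ω) : E :=
  z + twoSided Xp Xm (Y t ω) ω

/-- The first exit time `inf {t ≥ 0 | Z t ∉ D}` of a process from a set, with value `⊤` on the paths
that never leave `D`. -/
def exitTime {Ω E : Type*} (Z : ℝ≥0 → Ω → E) (D : Set E) : Ω → WithTop ℝ≥0 :=
  hittingAfter Z Dᶜ 0

end IteratedBM

end

namespace IteratedBM

/-! Let M and m be the maximum and minus the minimum of Y on [0,t]. Since Y is continuous it fills
[-m, M], so almost surely Z stays in D up to time t exactly when X⁺ stays in D on [0,M] and X⁻ on
[0,m]. By independence, having M ≈ b and m ≈ a costs about p(b) p(a) P[Y stays in [-a,b] up to t],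
where p(s) = exp(-c s^β (1+o(1))) is the survival probability in D and the last factor decays like
exp(-π² t / (2(a+b)²)). With lengths measured in units of x = t^(1/(2+β)) one has t/x² = x^β, so all
costs are of order x^β = t^(β/(2+β)), and the problem is to minimise c a^β + c b^β + π²/(2(a+b)²).
Because β ≤ 1, a^β + b^β ≥ (a+b)^β: it is best to put the whole length on one side, and the minimum
of c u^β + π²/(2u²) is the constant claimed (`rate_le`, `exists_rate_eq'`).

Lower bound: `le_measureReal_lt_exitTime_iterated` with Y confined to [-δx, Kx], K the minimiser and
δ small. Upper bound: `measureReal_lt_exitTime_iterated_le`, a union bound over a finite grid of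
values of (M, m) whose number of cells does not depend on t.

The interval estimates are elementary. A sine is an eigenfunction of Gaussian convolution. The
half-wave on the interval itself is a subsolution of the killed Gaussian step for every step size,
which gives the lower bound along dyadic skeletons and then in continuous time. The half-wave on a
slightly wider interval is a supersolution for one small step, which gives the upper bound at any
smaller rate. -/

/-! ### Sine functions under one Gaussian step killed outside an interval -/

lemma setIntegral_Ioi_zero_comp_add (f : ℝ → ℝ) (c : ℝ) :
    ∫ w in Set.Ioi 0, f (w + c) = ∫ y in Set.Ioi c, f y := by
  have := (measurePreserving_add_right (volume : Measure ℝ) c).setIntegral_preimage_emb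
    (measurableEmbedding_addRight c) f (Set.Ioi c)
  simpa using this

lemma integral_cos_gaussianReal (θ A : ℝ) (v : ℝ≥0) :
    ∫ y, Real.cos (A + θ * y) ∂(gaussianReal 0 v) = Real.exp (-(θ ^ 2 * v / 2)) * Real.cos A := by
  have h := charFun_gaussianReal (μ := 0) (v := v) θ
  rw [charFun_apply_real] at h
  have hint : Integrable (fun y : ℝ => Complex.exp (θ * y * Complex.I)) (gaussianReal 0 v) := by
    refine (integrable_const (1 : ℝ)).mono' (by fun_prop) (ae_of_all _ fun y => ?_)
    rw [← Complex.ofReal_mul, Complex.norm_exp_ofReal_mul_I]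
  have h2 : ∫ y : ℝ, Complex.exp (A * Complex.I) * Complex.exp (θ * y * Complex.I) ∂(gaussianReal 0 v)
      = Complex.exp (A * Complex.I) * ((Real.exp (-(θ ^ 2 * v / 2)) : ℝ) : ℂ) := by
    rw [integral_const_mul, h]
    congr 1
    push_cast
    congr 1
    ring
  have h3 := congrArg Complex.re h2
  have h4 := integral_re (𝕜 := ℂ) (hint.const_mul (Complex.exp (A * Complex.I)))
  simp only [RCLike.re_eq_complex_re] at h4
  rw [← h4] at h3
  rw [Complex.re_mul_ofReal, Complex.exp_ofReal_mul_I_re] at h3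
  rw [mul_comm, ← h3]
  refine integral_congr_ae (ae_of_all _ fun y => ?_)
  simp only
  rw [← Complex.exp_add, ← add_mul, ← Complex.ofReal_mul, ← Complex.ofReal_add,
    Complex.exp_ofReal_mul_I_re]

lemma integral_sin_gaussianReal (θ A : ℝ) (v : ℝ≥0) :
    ∫ y, Real.sin (A + θ * y) ∂(gaussianReal 0 v) = Real.exp (-(θ ^ 2 * v / 2)) * Real.sin A := by
  have h := integral_cos_gaussianReal θ (A - Real.pi / 2) v
  rw [Real.cos_sub_pi_div_two] at h
  rw [← h]
  refine integral_congr_ae (ae_of_all _ fun y => ?_)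
  simp only
  rw [← Real.cos_sub_pi_div_two]
  congr 1
  ring

lemma hasDerivAt_gaussianPDFReal (v : ℝ≥0) (x : ℝ) :
    HasDerivAt (gaussianPDFReal 0 v) (-(x / v) * gaussianPDFReal 0 v x) x := by
  have h1 : HasDerivAt (fun x : ℝ => -(x - 0) ^ 2 / (2 * (v : ℝ))) (-(x / v)) x := by
    have := ((((hasDerivAt_id x).sub_const 0).pow 2).neg).div_const (2 * (v : ℝ))
    refine this.congr_deriv ?_
    rcases eq_or_ne (v : ℝ) 0 with h | h
    · simp [h]
    · simp; field_simp
  have h2 := (h1.exp).const_mul (√(2 * Real.pi * v))⁻¹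
  rw [show gaussianPDFReal 0 v = fun x => (√(2 * Real.pi * v))⁻¹ *
    Real.exp (-(x - 0) ^ 2 / (2 * (v : ℝ))) from rfl]
  refine h2.congr_deriv ?_
  ring

lemma tendsto_gaussianPDFReal_atTop {v : ℝ≥0} (hv : v ≠ 0) :
    Tendsto (gaussianPDFReal 0 v) atTop (𝓝 0) := by
  have hv' : (0 : ℝ) < v := by positivity
  have h1 : Tendsto (fun x : ℝ => -(x - 0) ^ 2 / (2 * (v : ℝ))) atTop atBot := by
    have : Tendsto (fun x : ℝ => x ^ 2 / (2 * (v : ℝ))) atTop atTop :=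
      (tendsto_pow_atTop two_ne_zero).atTop_div_const (by positivity)
    refine (tendsto_neg_atTop_atBot.comp this).congr fun x => ?_
    simp only [Function.comp, sub_zero]
    ring
  have := (Real.tendsto_exp_atBot.comp h1).const_mul (√(2 * Real.pi * v))⁻¹
  rw [mul_zero] at this
  exact this

/-- On w > 0 the density w ↦ φ(d + w) decreases because d ≥ 0, so each positive half-wave of the
sine outweighs the negative one after it. The proof integrates by parts. This fixes the sign of what
an eigenfunction loses beyond an endpoint. -/
lemma integral_sin_mul_gaussianPDFReal_nonneg {v : ℝ≥0} (hv : v ≠ 0) {θ d : ℝ} (hθ : 0 < θ)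
    (hd : 0 ≤ d) :
    0 ≤ ∫ w in Set.Ioi 0, Real.sin (θ * w) * gaussianPDFReal 0 v (d + w) := by
  have hv' : (0 : ℝ) < v := by positivity
  set φ := fun w : ℝ => gaussianPDFReal 0 v (d + w) with hφ
  have hφi : Integrable φ := (integrable_gaussianPDFReal 0 v).comp_add_left d
  have hφd : ∀ w, HasDerivAt φ (-((d + w) / v) * φ w) w := fun w => by
    have := (hasDerivAt_gaussianPDFReal v (d + w)).comp_const_add d w
    exact this
  have hxi : Integrable (fun x : ℝ => (x / v) * gaussianPDFReal 0 v x) := by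
    have h1 : Integrable (fun x : ℝ => x) (gaussianReal 0 v) :=
      (memLp_id_gaussianReal 1).integrable le_rfl
    rw [gaussianReal_of_var_ne_zero _ hv] at h1
    rw [integrable_withDensity_iff (measurable_gaussianPDF _ _)
      (ae_of_all _ fun _ => gaussianPDF_lt_top)] at h1
    refine (h1.const_mul (v : ℝ)⁻¹).congr (ae_of_all _ fun x => ?_)
    simp only [toReal_gaussianPDF]
    ring
  have hxi' : Integrable (fun w : ℝ => ((d + w) / v) * φ w) := hxi.comp_add_left d
  have hs : Integrable (fun w : ℝ => Real.sin (θ * w) * φ w) :=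
    hφi.bdd_mul (c := 1) (by fun_prop) (ae_of_all _ fun x => Real.abs_sin_le_one _)
  have hG : Integrable (fun w : ℝ => (1 - Real.cos (θ * w)) * (((d + w) / v) * φ w)) := by
    refine hxi'.bdd_mul (c := 2) (by fun_prop) (ae_of_all _ fun x => ?_)
    rw [Real.norm_eq_abs, abs_le]
    constructor <;> linarith [Real.cos_le_one (θ * x), Real.neg_one_le_cos (θ * x)]
  -- The primitive 1 - cos is nonnegative and vanishes at 0, so there is no boundary term.
  have hH : ∀ w ∈ Set.Ici (0 : ℝ), HasDerivAt (fun w => (1 - Real.cos (θ * w)) * φ w)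
      (θ * (Real.sin (θ * w) * φ w) - (1 - Real.cos (θ * w)) * (((d + w) / v) * φ w)) w := by
    intro w _
    have h1 : HasDerivAt (fun w => 1 - Real.cos (θ * w)) (θ * Real.sin (θ * w)) w := by
      have := (((hasDerivAt_id w).const_mul θ).cos).const_sub 1
      refine this.congr_deriv ?_
      simp; ring
    refine (h1.mul (hφd w)).congr_deriv ?_
    ring
  have hlim : Tendsto (fun w => (1 - Real.cos (θ * w)) * φ w) atTop (𝓝 0) := by
    have h0 : Tendsto φ atTop (𝓝 0) :=
      (tendsto_gaussianPDFReal_atTop hv).comp (tendsto_atTop_add_const_left _ d tendsto_id)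
    have h2 : Tendsto (fun w => 2 * φ w) atTop (𝓝 0) := by simpa using h0.const_mul 2
    refine squeeze_zero (fun w => ?_) (fun w => ?_) h2
    · exact mul_nonneg (by linarith [Real.cos_le_one (θ * w)]) (gaussianPDFReal_nonneg _ _ _)
    · exact mul_le_mul_of_nonneg_right (by linarith [Real.neg_one_le_cos (θ * w)])
        (gaussianPDFReal_nonneg _ _ _)
  have key := integral_Ioi_of_hasDerivAt_of_tendsto' hH
    (((hs.const_mul θ).sub hG).integrableOn) hlim
  rw [integral_sub (hs.const_mul θ).integrableOn hG.integrableOn, integral_const_mul] at key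
  simp only [mul_zero, Real.cos_zero, sub_self, zero_mul] at key
  have hpos : 0 ≤ ∫ w in Set.Ioi (0 : ℝ), (1 - Real.cos (θ * w)) * (((d + w) / v) * φ w) := by
    refine setIntegral_nonneg measurableSet_Ioi fun w hw => ?_
    have : 0 < w := hw
    refine mul_nonneg (by linarith [Real.cos_le_one (θ * w)]) (mul_nonneg (by positivity)
      (gaussianPDFReal_nonneg _ _ _))
  have : 0 ≤ θ * ∫ w in Set.Ioi (0 : ℝ), Real.sin (θ * w) * φ w := by linarith
  exact nonneg_of_mul_nonneg_right this hθ

/-- Without the indicator this is the eigenvalue identity. Just outside either endpoint the sine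
starts with a negative half-wave, so the discarded integrals are nonpositive and discarding them
only increases the value. -/
lemma le_integral_indicator_sin_gaussianReal {v : ℝ≥0} (hv : v ≠ 0) {a b x : ℝ} (hab : 0 < a + b)
    (hx : x ∈ Set.Icc (-a) b) :
    Real.exp (-((Real.pi / (a + b)) ^ 2 * v / 2)) * Real.sin (Real.pi / (a + b) * (x + a)) ≤
      ∫ y, (Set.Icc (-a) b).indicator (fun u => Real.sin (Real.pi / (a + b) * (u + a))) (x + y)
        ∂(gaussianReal 0 v) := by
  set θ := Real.pi / (a + b) with hθ
  have hθ0 : 0 < θ := by positivity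
  have hθL : θ * (a + b) = Real.pi := by rw [hθ]; field_simp
  obtain ⟨hx1, hx2⟩ := hx
  rw [← integral_sin_gaussianReal, integral_gaussianReal_eq_integral_smul hv,
    integral_gaussianReal_eq_integral_smul hv]
  simp only [smul_eq_mul]
  have hpdf := integrable_gaussianPDFReal 0 v
  set F := fun y => gaussianPDFReal 0 v y * Real.sin (θ * (x + a) + θ * y) with hF
  have hFi : Integrable F :=
    hpdf.mul_bdd (c := 1) (by fun_prop) (ae_of_all _ fun x => Real.abs_sin_le_one _)
  have e1 : ∫ y, gaussianPDFReal 0 v y *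
      (Set.Icc (-a) b).indicator (fun u => Real.sin (θ * (u + a))) (x + y) =
      ∫ y in Set.Icc (-a - x) (b - x), F y := by
    rw [← integral_indicator measurableSet_Icc]
    refine integral_congr_ae (ae_of_all _ fun y => ?_)
    simp only [Set.indicator, Set.mem_Icc, hF]
    by_cases h : -a ≤ x + y ∧ x + y ≤ b
    · rw [if_pos h, if_pos ⟨by linarith, by linarith⟩]
      congr 2; ring
    · rw [if_neg h, if_neg (fun h' => h ⟨by linarith, by linarith⟩), mul_zero]
  have e2 : ∫ y, F y = (∫ y in Set.Iio (-a - x), F y) + ((∫ y in Set.Icc (-a - x) (b - x), F y) +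
      ∫ y in Set.Ioi (b - x), F y) := by
    rw [← setIntegral_union (by
        rw [Set.disjoint_left]; rintro y ⟨_, h⟩ h'; exact absurd h' (not_lt.2 h))
      measurableSet_Ioi hFi.integrableOn hFi.integrableOn,
      Set.Icc_union_Ioi_eq_Ici (by linarith), ← setIntegral_union (by
        rw [Set.disjoint_left]; intro y h h'; exact absurd (show -a - x ≤ y from h') (not_le.2 h))
      measurableSet_Ici hFi.integrableOn hFi.integrableOn, Set.Iio_union_Ici, setIntegral_univ]
  have hR : ∫ y in Set.Ioi (b - x), F y ≤ 0 := by
    have h := integral_sin_mul_gaussianPDFReal_nonneg hv hθ0 (d := b - x) (by linarith)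
    have e : ∫ y in Set.Ioi (b - x), F y = ∫ w in Set.Ioi 0, F (w + (b - x)) := by
      rw [setIntegral_Ioi_zero_comp_add]
    rw [e, ← neg_nonneg, ← integral_neg]
    convert h using 3 with w
    simp only [hF]
    rw [show θ * (x + a) + θ * (w + (b - x)) = θ * w + θ * (a + b) by ring, hθL, Real.sin_add_pi,
      add_comm w]
    ring
  have hL : ∫ y in Set.Iio (-a - x), F y ≤ 0 := by
    have h := integral_sin_mul_gaussianPDFReal_nonneg hv hθ0 (d := a + x) (by linarith)
    have e : ∫ y in Set.Iio (-a - x), F y = ∫ w in Set.Ioi 0, F (-(w + (a + x))) := by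
      rw [setIntegral_Ioi_zero_comp_add (fun w => F (-w)), integral_comp_neg_Ioi,
        ← integral_Iic_eq_integral_Iio]
      congr 3; ring
    rw [e, ← neg_nonneg, ← integral_neg]
    convert h using 3 with w
    simp only [hF]
    rw [show θ * (x + a) + θ * -(w + (a + x)) = -(θ * w) by ring, Real.sin_neg]
    rw [show gaussianPDFReal 0 v (-(w + (a + x))) = gaussianPDFReal 0 v (a + x + w) by
      simp only [gaussianPDFReal]; congr 3; ring]
    ring
  have e0 : ∫ y, gaussianPDFReal 0 v y * Real.sin (θ * (x + a) + θ * y) = ∫ y, F y := rfl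
  rw [e1, e0, e2]
  linarith

/-- Chernoff bound on both sides at the optimal parameter η/v. The order v² is what matters: it must
be negligible against a gain linear in the step v. -/
lemma gaussianReal_abs_ge_le {v : ℝ≥0} (hv : v ≠ 0) {η : ℝ} (hη : 0 < η) :
    (gaussianReal 0 v).real {y | η ≤ |y|} ≤ 16 * v ^ 2 / η ^ 4 := by
  have hv' : (0 : ℝ) < v := by positivity
  have hE : Real.exp (-(η ^ 2 / (2 * v))) ≤ 8 * v ^ 2 / η ^ 4 := by
    set u := η ^ 2 / (2 * (v : ℝ)) with hu
    have hu0 : 0 < u := by positivity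
    have h1 : u ^ 2 / 2 ≤ Real.exp u := by
      linarith [Real.quadratic_le_exp_of_nonneg hu0.le]
    rw [Real.exp_neg]
    calc (Real.exp u)⁻¹ ≤ (u ^ 2 / 2)⁻¹ := inv_anti₀ (by positivity) h1
      _ = 8 * v ^ 2 / η ^ 4 := by rw [hu]; field_simp; ring
  have h1 := measure_ge_le_exp_mul_mgf (μ := gaussianReal 0 v) (X := id) (t := η / v) η
    (by positivity) (by simpa using integrable_exp_mul_gaussianReal (η / v))
  have h2 := measure_le_le_exp_mul_mgf (μ := gaussianReal 0 v) (X := id) (t := -(η / v)) (-η)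
    (by rw [neg_nonpos]; positivity) (by simpa using integrable_exp_mul_gaussianReal (-(η / v)))
  rw [mgf_id_gaussianReal, ← Real.exp_add] at h1 h2
  have e1 : -(η / v) * η + (0 * (η / v) + v * (η / v) ^ 2 / 2) = -(η ^ 2 / (2 * v)) := by
    field_simp; ring
  have e2 : -(-(η / v)) * -η + (0 * -(η / v) + v * (-(η / v)) ^ 2 / 2) = -(η ^ 2 / (2 * v)) := by
    field_simp; ring
  rw [e1] at h1
  rw [e2] at h2
  have h3 : (gaussianReal 0 v).real {y | η ≤ |y|} ≤
      (gaussianReal 0 v).real {y | η ≤ id y} + (gaussianReal 0 v).real {y | id y ≤ -η} := by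
    refine (measureReal_mono (fun y hy => ?_)).trans (measureReal_union_le _ _)
    rcases le_abs.1 (show η ≤ |y| from hy) with h | h
    · exact Or.inl h
    · exact Or.inr (show y ≤ -η by linarith)
  calc _ ≤ 8 * (v : ℝ) ^ 2 / η ^ 4 + 8 * v ^ 2 / η ^ 4 := by linarith
    _ = _ := by ring

/-- This sine is nonnegative on the interval widened by η at each end. For |y| < η the point x + y
stays there, so dropping the indicator can only increase the integrand; for |y| ≥ η the error is at
most 1. -/
lemma integral_indicator_sin_gaussianReal_le {v : ℝ≥0} (hv : v ≠ 0) {a b η x : ℝ} (hη : 0 < η)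
    (hx : x ∈ Set.Icc (-a) b) :
    ∫ y, (Set.Icc (-a) b).indicator
        (fun u => Real.sin (Real.pi / (a + b + 2 * η) * (u + (a + η)))) (x + y)
        ∂(gaussianReal 0 v) ≤
      Real.exp (-((Real.pi / (a + b + 2 * η)) ^ 2 * v / 2)) *
        Real.sin (Real.pi / (a + b + 2 * η) * (x + (a + η))) + 16 * v ^ 2 / η ^ 4 := by
  obtain ⟨hx1, hx2⟩ := hx
  set θ := Real.pi / (a + b + 2 * η) with hθ
  have hL : 0 < a + b + 2 * η := by linarith
  have hθ0 : 0 < θ := by positivity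
  have hθL : θ * (a + b + 2 * η) = Real.pi := by rw [hθ]; field_simp
  have hms : MeasurableSet {y : ℝ | η ≤ |y|} := measurableSet_le measurable_const (by fun_prop)
  have hi2 : Integrable ({y : ℝ | η ≤ |y|}.indicator fun _ => (1 : ℝ)) (gaussianReal 0 v) :=
    (integrable_const 1).indicator hms
  have hi1 : Integrable (fun y => Real.sin (θ * (x + (a + η)) + θ * y)) (gaussianReal 0 v) :=
    (integrable_const (1 : ℝ)).mono' (by fun_prop) (ae_of_all _ fun x => Real.abs_sin_le_one _)
  refine le_trans ?_ (add_le_add_right (gaussianReal_abs_ge_le hv hη) _)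
  rw [← integral_sin_gaussianReal, ← integral_indicator_one hms]
  rw [← integral_add hi1 (by exact hi2)]
  refine integral_mono_of_nonneg (ae_of_all _ fun y => ?_) (hi1.add hi2) (ae_of_all _ fun y => ?_)
  · refine Set.indicator_nonneg (fun u hu => ?_) _
    refine Real.sin_nonneg_of_nonneg_of_le_pi (mul_nonneg hθ0.le (by linarith [hu.1])) ?_
    rw [← hθL]
    exact mul_le_mul_of_nonneg_left (by linarith [hu.2]) hθ0.le
  · have e : θ * (x + (a + η)) + θ * y = θ * (x + y + (a + η)) := by ring
    simp only [e]
    by_cases h : η ≤ |y|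
    · simp only [Set.indicator, Set.mem_ofPred_eq, h, if_true, Pi.one_apply]
      split_ifs <;> linarith [Real.neg_one_le_sin (θ * (x + y + (a + η)))]
    · have h' := abs_lt.1 (not_le.1 h)
      have hs : 0 ≤ Real.sin (θ * (x + y + (a + η))) := by
        refine Real.sin_nonneg_of_nonneg_of_le_pi (mul_nonneg hθ0.le (by linarith)) ?_
        rw [← hθL]
        exact mul_le_mul_of_nonneg_left (by linarith) hθ0.le
      simp only [Set.indicator, Set.mem_ofPred_eq, h, if_false, add_zero]
      split_ifs
      · exact le_rfl
      · exact hs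

/-- For every rate below the principal Dirichlet eigenvalue of an interval, a strict supersolution
of the one-step killed Gaussian kernel, at a suitable step size. -/
lemma exists_supersolution {a b lam : ℝ} (hab : 0 < a + b)
    (hlam : lam < Real.pi ^ 2 / (2 * (a + b) ^ 2)) :
    ∃ (v : ℝ≥0) (f : ℝ → ℝ) (m : ℝ), v ≠ 0 ∧ 0 < m ∧ Measurable f ∧ (∀ x, |f x| ≤ 1) ∧
      (∀ x ∈ Set.Icc (-a) b, m ≤ f x) ∧
      ∀ x ∈ Set.Icc (-a) b, ∫ y, (Set.Icc (-a) b).indicator f (x + y) ∂(gaussianReal 0 v) ≤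
        Real.exp (-(lam * v)) * f x := by
  -- The strict inequality leaves room to widen the interval by η at each end.
  obtain ⟨η, hη, hη'⟩ : ∃ η : ℝ, 0 < η ∧ lam < Real.pi ^ 2 / (2 * (a + b + 2 * η) ^ 2) := by
    have hc : ContinuousAt (fun η : ℝ => Real.pi ^ 2 / (2 * (a + b + 2 * η) ^ 2)) 0 := by
      refine ContinuousAt.div (by fun_prop) (by fun_prop) ?_
      simp only [mul_zero, add_zero]; positivity
    have h1 : ∀ᶠ η in 𝓝 (0 : ℝ), lam < Real.pi ^ 2 / (2 * (a + b + 2 * η) ^ 2) :=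
      hc.eventually (lt_mem_nhds (by simpa using hlam))
    have h2 : ∀ᶠ η in 𝓝[>] (0 : ℝ), lam < Real.pi ^ 2 / (2 * (a + b + 2 * η) ^ 2) :=
      h1.filter_mono nhdsWithin_le_nhds
    obtain ⟨η, h, h'⟩ := (h2.and self_mem_nhdsWithin).exists
    exact ⟨η, h', h⟩
  have hL : 0 < a + b + 2 * η := by linarith
  set θ := Real.pi / (a + b + 2 * η) with hθ
  have hθ0 : 0 < θ := by positivity
  have hθL : θ * (a + b + 2 * η) = Real.pi := by rw [hθ]; field_simp
  set mu := θ ^ 2 / 2 with hmu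
  have hmu' : lam < mu := by
    refine hη'.trans_eq ?_
    rw [hmu, hθ]; field_simp
  set m := Real.sin (θ * η) with hm
  have hηπ : θ * η < Real.pi / 2 := by
    have : θ * η * 2 < Real.pi := by rw [← hθL]; nlinarith
    linarith
  have hm0 : 0 < m := Real.sin_pos_of_pos_of_lt_pi (by positivity) (by linarith [Real.pi_pos])
  -- For 0 < h ≤ 1, κh is at most exp(-lam h) - exp(-mu h); the step h is then taken so small that
  -- the tail 16h²/η⁴ is at most κhm.
  set κ := (mu - lam) * Real.exp (-mu) with hκ
  have hκ0 : 0 < κ := mul_pos (by linarith) (Real.exp_pos _)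
  set h : ℝ := min 1 (κ * η ^ 4 * m / 16) with hh
  have hh0 : 0 < h := by positivity
  have hh1 : h ≤ 1 := min_le_left _ _
  have hh2 : h ≤ κ * η ^ 4 * m / 16 := min_le_right _ _
  have hfm : ∀ x ∈ Set.Icc (-a) b, m ≤ Real.sin (θ * (x + (a + η))) := by
    rintro x ⟨hx1, hx2⟩
    by_cases hc : θ * (x + (a + η)) ≤ Real.pi / 2
    · refine Real.sin_le_sin_of_le_of_le_pi_div_two ?_ hc ?_
      · have : 0 ≤ θ * η := by positivity
        linarith [Real.pi_pos]
      · exact mul_le_mul_of_nonneg_left (by linarith) hθ0.le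
    · rw [← Real.sin_pi_sub (θ * (x + (a + η)))]
      refine Real.sin_le_sin_of_le_of_le_pi_div_two ?_ ?_ ?_
      · have : 0 ≤ θ * η := by positivity
        linarith [Real.pi_pos]
      · linarith
      · rw [← hθL, ← mul_sub]
        exact mul_le_mul_of_nonneg_left (by linarith) hθ0.le
  have hv : h.toNNReal ≠ 0 := by simpa using hh0
  refine ⟨h.toNNReal, fun x => Real.sin (θ * (x + (a + η))), m, hv, hm0, by fun_prop,
    fun x => Real.abs_sin_le_one _, hfm, fun x hx => ?_⟩
  refine (integral_indicator_sin_gaussianReal_le hv hη hx).trans ?_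
  rw [Real.coe_toNNReal _ hh0.le, ← hθ]
  have hf := hfm x hx
  set s := Real.sin (θ * (x + (a + η)))
  have e1 : 16 * h ^ 2 / η ^ 4 ≤ κ * h * m := by
    rw [div_le_iff₀ (by positivity)]
    nlinarith
  have e2 : Real.exp (-(θ ^ 2 * h / 2)) + κ * h ≤ Real.exp (-(lam * h)) := by
    have h1 : Real.exp (-(lam * h)) = Real.exp (-(mu * h)) * Real.exp ((mu - lam) * h) := by
      rw [← Real.exp_add]; ring_nf
    have h2 : 1 + (mu - lam) * h ≤ Real.exp ((mu - lam) * h) := by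
      linarith [Real.add_one_le_exp ((mu - lam) * h)]
    have h3 : Real.exp (-mu) ≤ Real.exp (-(mu * h)) := by
      apply Real.exp_le_exp.2
      have : 0 ≤ mu := by positivity
      nlinarith
    have h4 : -(θ ^ 2 * h / 2) = -(mu * h) := by rw [hmu]; ring
    rw [h4, h1, hκ]
    have h5 : 0 ≤ (mu - lam) * h := mul_nonneg (by linarith) hh0.le
    nlinarith [Real.exp_pos (-(mu * h)), mul_le_mul_of_nonneg_left h3 h5,
      mul_le_mul_of_nonneg_left h2 (Real.exp_pos (-(mu * h))).le]
  have e3 : κ * h * m ≤ κ * h * s := mul_le_mul_of_nonneg_left hf (by positivity)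
  have e4 := mul_le_mul_of_nonneg_right e2 (hm0.le.trans hf)
  linarith

/-! ### Discrete skeletons of a Brownian motion in an interval -/

section Skeleton

variable {Ω : Type*} [MeasurableSpace Ω] {P : Measure Ω} {Y : ℝ≥0 → Ω → ℝ}

/-- The event that the first `k + 1` points of the skeleton of `Y` with step `h` lie in `I`. -/
def skeletonIn (Y : ℝ≥0 → Ω → ℝ) (h : ℝ≥0) (I : Set ℝ) (k : ℕ) : Set Ω :=
  {ω | ∀ j : Fin (k + 1), Y ((j : ℕ) * h) ω ∈ I}

lemma nullMeasurableSet_skeletonIn (hY : IsPreBrownianReal Y P) (h : ℝ≥0) {I : Set ℝ}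
    (hI : MeasurableSet I) (k : ℕ) : NullMeasurableSet (skeletonIn Y h I k) P := by
  rw [skeletonIn, Set.ofPred_forall]
  exact NullMeasurableSet.iInter fun j => (hY.aemeasurable _).nullMeasurableSet_preimage hI

/-- The expectation of `g` at the last point of the skeleton, on the event that the skeleton stays
in `I`. -/
noncomputable def skeletonMean (P : Measure Ω) (Y : ℝ≥0 → Ω → ℝ) (h : ℝ≥0) (I : Set ℝ) (g : ℝ → ℝ) (k : ℕ) : ℝ :=
  ∫ ω, (skeletonIn Y h I k).indicator (fun ω => g (Y (k * h) ω)) ω ∂P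

lemma integrable_skeleton [IsFiniteMeasure P] (hY : IsPreBrownianReal Y P) (h : ℝ≥0) {I : Set ℝ}
    (hI : MeasurableSet I) {g : ℝ → ℝ} (hg : Measurable g) {C : ℝ} (hC : ∀ x, |g x| ≤ C) (k : ℕ) :
    Integrable ((skeletonIn Y h I k).indicator (fun ω => g (Y (k * h) ω))) P := by
  refine Integrable.indicator₀ ?_ (nullMeasurableSet_skeletonIn hY h hI k)
  refine (integrable_const C).mono' ?_ (ae_of_all _ fun ω => hC _)
  exact (hg.comp_aemeasurable (hY.aemeasurable _)).aestronglyMeasurable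

/-- Markov property: the last increment is Gaussian with variance h and independent of the earlier
skeleton points, so Fubini integrates it out first. -/
lemma skeletonMean_succ [IsProbabilityMeasure P] (hY : IsPreBrownianReal Y P) (h : ℝ≥0) {I : Set ℝ}
    (hI : MeasurableSet I) {g : ℝ → ℝ} (hg : Measurable g) {C : ℝ} (hC : ∀ x, |g x| ≤ C) (k : ℕ) :
    skeletonMean P Y h I g (k + 1) =
      skeletonMean P Y h I (fun x => ∫ y, I.indicator g (x + y) ∂(gaussianReal 0 h)) k := by
  have hC0 : 0 ≤ C := (abs_nonneg _).trans (hC 0)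
  set t₀ : ℝ≥0 := k * h with ht₀
  set U : Ω → Fin (k + 1) → ℝ := fun ω j => Y ((j : ℕ) * h) ω with hU
  set ξ : Ω → ℝ := fun ω => Y (t₀ + h) ω - Y t₀ ω with hξ
  have hUm : AEMeasurable U P := aemeasurable_pi_lambda _ fun j => hY.aemeasurable _
  have hξm : AEMeasurable ξ P := (hY.aemeasurable _).sub (hY.aemeasurable _)
  have hind : IndepFun U ξ P := by
    have h1 := (hY.indepFun_shift t₀).symm
    have hle : ∀ j : Fin (k + 1), ((j : ℕ) : ℝ≥0) * h ≤ t₀ := fun j => by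
      rw [ht₀]
      gcongr
      exact Nat.lt_succ_iff.1 j.2
    have hψ : Measurable fun w : ℝ≥0 → ℝ => w h := measurable_pi_apply h
    exact h1.comp (φ := fun w (j : Fin (k + 1)) => w ⟨((j : ℕ) : ℝ≥0) * h, hle j⟩)
      (ψ := fun w => w h) (by fun_prop) hψ
  have hlaw : P.map ξ = gaussianReal 0 h := by
    have := (hY.shift t₀).hasLaw_eval h
    exact this.map_eq
  set A : Set (Fin (k + 1) → ℝ) := {u | ∀ j, u j ∈ I} with hA
  have hAm : MeasurableSet A := by
    rw [hA, Set.ofPred_forall]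
    exact MeasurableSet.iInter fun j => hI.preimage (measurable_pi_apply j)
  set F : (Fin (k + 1) → ℝ) × ℝ → ℝ := fun p =>
    A.indicator 1 p.1 * I.indicator g (p.1 (Fin.last k) + p.2) with hF
  have hFm : Measurable F := by
    refine ((measurable_one.indicator hAm).comp measurable_fst).mul ((hg.indicator hI).comp ?_)
    fun_prop
  have hAb : ∀ u, |A.indicator (1 : (Fin (k + 1) → ℝ) → ℝ) u| ≤ 1 := fun u => by
    by_cases hu : u ∈ A <;> simp [hu]
  have hFb : ∀ p, |F p| ≤ C := fun p => by
    rw [hF]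
    simp only [abs_mul]
    have h2 : |I.indicator g (p.1 (Fin.last k) + p.2)| ≤ C := by
      by_cases hu : p.1 (Fin.last k) + p.2 ∈ I <;> simp [hu, hC, hC0]
    calc _ ≤ 1 * C := mul_le_mul (hAb _) h2 (abs_nonneg _) zero_le_one
      _ = C := one_mul C
  have : IsProbabilityMeasure (P.map U) := Measure.isProbabilityMeasure_map hUm
  have hmap : P.map (fun ω => (U ω, ξ ω)) = (P.map U).prod (gaussianReal 0 h) := by
    rw [(indepFun_iff_map_prod_eq_prod_map_map hUm hξm).1 hind, hlaw]
  have e1 : skeletonMean P Y h I g (k + 1) = ∫ ω, F (U ω, ξ ω) ∂P := by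
    refine integral_congr_ae (ae_of_all _ fun ω => ?_)
    have hlast : U ω (Fin.last k) + ξ ω = Y ((k + 1 : ℕ) * h) ω := by
      simp only [hU, hξ, Fin.val_last, ← ht₀]
      rw [show ((k + 1 : ℕ) : ℝ≥0) * h = t₀ + h by rw [ht₀]; push_cast; ring]
      ring
    simp only [hF, hlast]
    have hiff : ω ∈ skeletonIn Y h I (k + 1) ↔ U ω ∈ A ∧ Y ((k + 1 : ℕ) * h) ω ∈ I := by
      simp only [skeletonIn, hA, Set.mem_ofPred_eq]
      rw [Fin.forall_fin_succ']
      simp [hU]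
    by_cases h1 : U ω ∈ A <;> by_cases h2 : Y ((k + 1 : ℕ) * h) ω ∈ I <;>
      simp only [Set.indicator, hiff, h1, h2, and_self, and_true, and_false, if_true, if_false,
        Pi.one_apply, one_mul, zero_mul, mul_zero]
  have hFint : Integrable F ((P.map U).prod (gaussianReal 0 h)) :=
    (integrable_const C).mono' hFm.aestronglyMeasurable (ae_of_all _ hFb)
  have e2 : ∫ ω, F (U ω, ξ ω) ∂P = ∫ u, ∫ y, F (u, y) ∂(gaussianReal 0 h) ∂(P.map U) := by
    rw [← integral_prod _ hFint, ← hmap,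
      integral_map (hUm.prodMk hξm) hFm.aestronglyMeasurable]
  rw [e1, e2, integral_map hUm]
  · refine integral_congr_ae (ae_of_all _ fun ω => ?_)
    simp only [hF]
    rw [integral_const_mul]
    have hiff : ω ∈ skeletonIn Y h I k ↔ U ω ∈ A := Iff.rfl
    have hlast : U ω (Fin.last k) = Y (k * h) ω := by simp [hU]
    rw [hlast]
    by_cases h1 : U ω ∈ A
    · rw [Set.indicator_of_mem h1, Set.indicator_of_mem (hiff.2 h1), Pi.one_apply, one_mul]
    · rw [Set.indicator_of_notMem h1, Set.indicator_of_notMem (fun h2 => h1 (hiff.1 h2)), zero_mul]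
  · exact hFint.integral_prod_left.aestronglyMeasurable

lemma measurable_integral_indicator (h : ℝ≥0) {I : Set ℝ}
    (hI : MeasurableSet I) {g : ℝ → ℝ} (hg : Measurable g) :
    Measurable fun x => ∫ y, I.indicator g (x + y) ∂(gaussianReal 0 h) := by
  have : StronglyMeasurable (Function.uncurry fun x y : ℝ => I.indicator g (x + y)) :=
    ((hg.indicator hI).comp (measurable_fst.add measurable_snd)).stronglyMeasurable
  exact this.integral_prod_right.measurable

lemma abs_integral_indicator_le (h : ℝ≥0) {I : Set ℝ} {g : ℝ → ℝ} {C : ℝ}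
    (hC : ∀ x, |g x| ≤ C) (x : ℝ) :
    |∫ y, I.indicator g (x + y) ∂(gaussianReal 0 h)| ≤ C := by
  have := norm_integral_le_of_norm_le_const (μ := gaussianReal 0 h) (C := C)
    (f := fun y => I.indicator g (x + y)) (ae_of_all _ fun y => ?_)
  · simpa using this
  · rw [Real.norm_eq_abs]
    have hC0 : 0 ≤ C := (abs_nonneg _).trans (hC 0)
    by_cases hu : x + y ∈ I <;> simp [hu, hC, hC0]

lemma skeletonMean_mono [IsFiniteMeasure P] (hY : IsPreBrownianReal Y P) (h : ℝ≥0) {I : Set ℝ}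
    (hI : MeasurableSet I) {f g : ℝ → ℝ} (hf : Measurable f) (hg : Measurable g) {C : ℝ}
    (hfC : ∀ x, |f x| ≤ C) (hgC : ∀ x, |g x| ≤ C) (hfg : ∀ x ∈ I, f x ≤ g x) (k : ℕ) :
    skeletonMean P Y h I f k ≤ skeletonMean P Y h I g k := by
  refine integral_mono (integrable_skeleton hY h hI hf hfC k)
    (integrable_skeleton hY h hI hg hgC k) fun ω => ?_
  refine Set.indicator_le_indicator' fun hω => hfg _ ?_
  have := hω (Fin.last k)
  simpa using this

lemma skeletonMean_const_mul (h : ℝ≥0) (I : Set ℝ) (g : ℝ → ℝ) (ρ : ℝ) (k : ℕ) :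
    skeletonMean P Y h I (fun x => ρ * g x) k = ρ * skeletonMean P Y h I g k := by
  rw [skeletonMean, skeletonMean, ← integral_const_mul]
  refine integral_congr_ae (ae_of_all _ fun ω => ?_)
  simp only [Set.indicator]
  split_ifs <;> simp

lemma skeletonMean_zero [IsProbabilityMeasure P] (hY : IsPreBrownianReal Y P) (h : ℝ≥0) {I : Set ℝ}
    (h0 : (0 : ℝ) ∈ I) (g : ℝ → ℝ) :
    skeletonMean P Y h I g 0 = g 0 := by
  have : ∀ᵐ ω ∂P, (skeletonIn Y h I 0).indicator (fun ω => g (Y ((0 : ℕ) * h) ω)) ω = g 0 := by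
    filter_upwards [hY.eval_zero_ae_eq_zero] with ω hω
    have h1 : ω ∈ skeletonIn Y h I 0 := fun j => by simpa [hω] using h0
    rw [Set.indicator_of_mem h1]
    simp [hω]
  rw [skeletonMean, integral_congr_ae this]
  simp

lemma skeletonMean_one [IsProbabilityMeasure P] (hY : IsPreBrownianReal Y P) (h : ℝ≥0) {I : Set ℝ}
    (hI : MeasurableSet I) (k : ℕ) :
    skeletonMean P Y h I (fun _ => 1) k = P.real (skeletonIn Y h I k) := by
  rw [skeletonMean, integral_indicator₀ (nullMeasurableSet_skeletonIn hY h hI k)]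
  simp

lemma pow_le_skeletonMean [IsProbabilityMeasure P] (hY : IsPreBrownianReal Y P) (h : ℝ≥0)
    {I : Set ℝ} (hI : MeasurableSet I) (h0 : (0 : ℝ) ∈ I) {g : ℝ → ℝ} (hg : Measurable g)
    (hC : ∀ x, |g x| ≤ 1) {ρ : ℝ} (hρ0 : 0 ≤ ρ) (hρ1 : ρ ≤ 1)
    (hρ : ∀ x ∈ I, ρ * g x ≤ ∫ y, I.indicator g (x + y) ∂(gaussianReal 0 h)) (k : ℕ) :
    ρ ^ k * g 0 ≤ skeletonMean P Y h I g k := by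
  induction k with
  | zero => rw [skeletonMean_zero hY h h0]; simp
  | succ k ih =>
    rw [skeletonMean_succ hY h hI hg hC, pow_succ']
    have h1 : ∀ x, |ρ * g x| ≤ 1 := fun x => by
      rw [abs_mul, abs_of_nonneg hρ0]
      exact mul_le_one₀ hρ1 (abs_nonneg _) (hC x)
    have h2 := skeletonMean_mono (P := P) hY h hI (hg.const_mul ρ)
      (measurable_integral_indicator h hI hg) h1 (abs_integral_indicator_le h hC) hρ k
    rw [skeletonMean_const_mul] at h2
    refine le_trans ?_ h2
    rw [mul_assoc]
    exact mul_le_mul_of_nonneg_left ih hρ0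

lemma skeletonMean_le_pow [IsProbabilityMeasure P] (hY : IsPreBrownianReal Y P) (h : ℝ≥0)
    {I : Set ℝ} (hI : MeasurableSet I) (h0 : (0 : ℝ) ∈ I) {g : ℝ → ℝ} (hg : Measurable g)
    (hC : ∀ x, |g x| ≤ 1) {ρ : ℝ} (hρ0 : 0 ≤ ρ)
    (hρ : ∀ x ∈ I, ∫ y, I.indicator g (x + y) ∂(gaussianReal 0 h) ≤ ρ * g x) (k : ℕ) :
    skeletonMean P Y h I g k ≤ ρ ^ k * g 0 := by
  induction k with
  | zero => rw [skeletonMean_zero hY h h0]; simp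
  | succ k ih =>
    rw [skeletonMean_succ hY h hI hg hC, pow_succ']
    have h1 : ∀ x, |ρ * g x| ≤ max 1 ρ := fun x => by
      rw [abs_mul, abs_of_nonneg hρ0]
      exact (mul_le_of_le_one_right hρ0 (hC x)).trans (le_max_right _ _)
    have h2 := skeletonMean_mono (P := P) hY h hI
      (measurable_integral_indicator h hI hg) (hg.const_mul ρ)
      (fun x => (abs_integral_indicator_le h hC x).trans (le_max_left _ _)) h1 hρ k
    rw [skeletonMean_const_mul] at h2
    refine h2.trans ?_
    rw [mul_assoc]
    exact mul_le_mul_of_nonneg_left ih hρ0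

/-- Iterates the sine subsolution and bounds the sine by 1. The bound depends on step and number of
steps only through their product, so it survives refinement of the skeleton. -/
lemma le_measureReal_skeletonIn [IsProbabilityMeasure P] (hY : IsPreBrownianReal Y P) {h : ℝ≥0}
    (hh : h ≠ 0) {a b : ℝ} (ha : 0 ≤ a) (hb : 0 ≤ b) (hab : 0 < a + b) (k : ℕ) :
    Real.sin (Real.pi * a / (a + b)) * Real.exp (-(Real.pi ^ 2 / (2 * (a + b) ^ 2) * (k * h))) ≤
      P.real (skeletonIn Y h (Set.Icc (-a) b) k) := by
  have h0 : (0 : ℝ) ∈ Set.Icc (-a) b := ⟨by linarith, hb⟩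
  have hg : Measurable fun u => Real.sin (Real.pi / (a + b) * (u + a)) := by fun_prop
  have hρ1 : Real.exp (-((Real.pi / (a + b)) ^ 2 * h / 2)) ≤ 1 := by
    rw [Real.exp_le_one_iff, neg_nonpos]; positivity
  have h1 := pow_le_skeletonMean hY h measurableSet_Icc h0 hg (fun x => Real.abs_sin_le_one _)
    (Real.exp_pos _).le hρ1 (fun x hx => le_integral_indicator_sin_gaussianReal hh hab hx) k
  have h2 := skeletonMean_mono (P := P) hY h (measurableSet_Icc (a := -a) (b := b)) hg
    measurable_const (C := 1) (fun x => Real.abs_sin_le_one _) (g := fun _ => 1) (by simp)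
    (fun x _ => Real.sin_le_one _) k
  rw [skeletonMean_one hY h measurableSet_Icc] at h2
  refine le_trans (le_of_eq ?_) (h1.trans h2)
  rw [← Real.exp_nat_mul, mul_comm, zero_add]
  congr 2
  · field_simp
  · ring

/-- Exponential decay of the probability that a Brownian motion has not left an interval by
time `T`, at any rate below the principal Dirichlet eigenvalue. -/
lemma exists_forall_measureReal_le {a b lam : ℝ} (ha : 0 ≤ a) (hb : 0 ≤ b) (hab : 0 < a + b)
    (hlam : lam < Real.pi ^ 2 / (2 * (a + b) ^ 2)) :
    ∃ C : ℝ, 0 < C ∧ ∀ {Ω : Type*} [MeasurableSpace Ω] (P : Measure Ω) [IsProbabilityMeasure P]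
      (Y : ℝ≥0 → Ω → ℝ), IsPreBrownianReal Y P → ∀ T : ℝ≥0,
        P.real {ω | ∀ s ≤ T, Y s ω ∈ Set.Icc (-a) b} ≤ C * Real.exp (-(lam * T)) := by
  wlog hlam0 : 0 ≤ lam generalizing lam
  · obtain ⟨C, hC0, hC⟩ := this (lam := 0) (by positivity) le_rfl
    refine ⟨C, hC0, fun P _ Y hY T => (hC P Y hY T).trans ?_⟩
    gcongr
    linarith
  obtain ⟨v, f, m, hv, hm, hf, hf1, hfm, hstep⟩ := exists_supersolution hab hlam
  have h0 : (0 : ℝ) ∈ Set.Icc (-a) b := ⟨by linarith, hb⟩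
  have hv' : (0 : ℝ) < v := by positivity
  -- The factor 1/m comes from f ≥ m on the interval, and exp(lam v) from rounding T down to a
  -- multiple of v. Neither depends on the process, which later permits Brownian scaling.
  refine ⟨Real.exp (lam * v) / m, by positivity, fun {Ω} _ P _ Y hY T => ?_⟩
  set N := ⌊(T : ℝ) / v⌋₊ with hN
  have hN1 : (N : ℝ) * v ≤ T := by
    rw [← le_div_iff₀ hv']; exact Nat.floor_le (by positivity)
  have hN2 : (T : ℝ) ≤ (N + 1) * v := by
    rw [← div_le_iff₀ hv']; exact (Nat.lt_floor_add_one _).le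
  have h1 := skeletonMean_le_pow (P := P) hY v measurableSet_Icc h0 hf hf1 (Real.exp_pos _).le
    hstep N
  have h2 := skeletonMean_mono (P := P) hY v (measurableSet_Icc (a := -a) (b := b))
    (measurable_const (a := m)) hf (C := max 1 m) (fun x => by rw [abs_of_pos hm]; simp)
    (fun x => (hf1 x).trans (le_max_left _ _)) hfm N
  have h3 := skeletonMean_const_mul (P := P) (Y := Y) v (Set.Icc (-a) b) (fun _ => 1) m N
  simp only [mul_one] at h3
  rw [h3, skeletonMean_one hY v measurableSet_Icc] at h2
  have h4 : Real.exp (-(lam * v)) ^ N * f 0 ≤ Real.exp (lam * v) * Real.exp (-(lam * T)) := by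
    rw [← Real.exp_nat_mul, ← Real.exp_add]
    refine (mul_le_of_le_one_right (Real.exp_pos _).le ((abs_le.1 (hf1 0)).2)).trans ?_
    apply Real.exp_le_exp.2
    nlinarith
  have h5 : P.real {ω | ∀ s ≤ T, Y s ω ∈ Set.Icc (-a) b} ≤
      P.real (skeletonIn Y v (Set.Icc (-a) b) N) := by
    refine measureReal_mono fun ω hω j => hω _ ?_
    rw [← NNReal.coe_le_coe]
    push_cast
    refine le_trans ?_ hN1
    gcongr
    exact Nat.lt_succ_iff.1 j.2
  refine h5.trans ?_
  rw [div_mul_eq_mul_div, le_div_iff₀ hm, mul_comm]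
  exact h2.trans (h1.trans h4)

end Skeleton

/-! ### Confinement to an interval in continuous time -/

section StayLower

variable {Ω : Type*} [MeasurableSpace Ω] {P : Measure Ω} {Y : ℝ≥0 → Ω → ℝ}

lemma forall_mem_of_dyadic {w : ℝ≥0 → ℝ} (hw : Continuous w) {T : ℝ≥0} (hT : T ≠ 0) {I : Set ℝ}
    (hI : IsClosed I) (h : ∀ n j : ℕ, j ≤ 2 ^ n → w (j * (T / 2 ^ n)) ∈ I) :
    ∀ s ≤ T, w s ∈ I := by
  intro s hs
  have hT' : (0 : ℝ) < T := by positivity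
  have h1 : Tendsto (fun n : ℕ => (⌊(s / T : ℝ) * 2 ^ n⌋₊ : ℝ) / 2 ^ n) atTop (𝓝 (s / T)) :=
    (tendsto_nat_floor_mul_div_atTop (by positivity : (0 : ℝ) ≤ s / T)).comp
      (tendsto_pow_atTop_atTop_of_one_lt (one_lt_two : (1 : ℝ) < 2))
  have h2 : Tendsto (fun n : ℕ => (⌊(s / T : ℝ) * 2 ^ n⌋₊ : ℝ≥0) * (T / 2 ^ n)) atTop (𝓝 s) := by
    rw [← NNReal.tendsto_coe]
    have h3 := h1.mul_const (T : ℝ)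
    rw [div_mul_cancel₀ (s : ℝ) hT'.ne'] at h3
    refine h3.congr fun n => ?_
    push_cast
    ring
  refine hI.mem_of_tendsto ((hw.tendsto s).comp h2) (Eventually.of_forall fun n => h n _ ?_)
  apply Nat.floor_le_of_le
  push_cast
  exact mul_le_of_le_one_left (by positivity) (div_le_one_of_le₀ (by exact_mod_cast hs) hT'.le)

lemma le_measureReal_forall_mem_Icc [IsProbabilityMeasure P] (hY : IsBrownianReal Y P) {T : ℝ≥0}
    (hT : T ≠ 0) {a b : ℝ} (ha : 0 ≤ a) (hb : 0 ≤ b) (hab : 0 < a + b) :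
    Real.sin (Real.pi * a / (a + b)) * Real.exp (-(Real.pi ^ 2 / (2 * (a + b) ^ 2) * T)) ≤
      P.real {ω | ∀ s ≤ T, Y s ω ∈ Set.Icc (-a) b} := by
  set A : ℕ → Set Ω := fun n => skeletonIn Y (T / 2 ^ n) (Set.Icc (-a) b) (2 ^ n) with hA
  have hAn : ∀ n, NullMeasurableSet (A n) P := fun n =>
    nullMeasurableSet_skeletonIn hY.toIsPreBrownianReal _ measurableSet_Icc _
  -- The j-th point at level n is the 2j-th point at level n + 1.
  have hanti : Antitone A := by
    refine antitone_nat_of_succ_le fun n ω hω j => ?_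
    have := hω ⟨2 * j, by have := j.2; rw [pow_succ]; omega⟩
    convert this using 2
    push_cast
    rw [pow_succ]
    field_simp
  have hlim := tendsto_measure_iInter_atTop hAn hanti ⟨0, measure_ne_top P _⟩
  have hlim' : Tendsto (fun n => P.real (A n)) atTop (𝓝 (P.real (⋂ n, A n))) :=
    (ENNReal.tendsto_toReal (measure_ne_top P _)).comp hlim
  have hsub : ⋂ n, A n ≤ᵐ[P] {ω | ∀ s ≤ T, Y s ω ∈ Set.Icc (-a) b} := by
    filter_upwards [hY.cont] with ω hω hmem
    refine forall_mem_of_dyadic hω hT isClosed_Icc fun n j hj => ?_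
    exact Set.mem_iInter.1 hmem n ⟨j, Nat.lt_succ_iff.2 hj⟩
  refine le_trans (ge_of_tendsto' hlim' fun n => ?_)
    (ENNReal.toReal_mono (measure_ne_top P _) (measure_mono_ae hsub))
  have h := le_measureReal_skeletonIn hY.toIsPreBrownianReal (h := T / 2 ^ n)
    (div_ne_zero hT (by positivity)) ha hb hab (2 ^ n)
  refine le_trans (le_of_eq ?_) h
  push_cast
  rw [mul_div_cancel₀ (T : ℝ) (by positivity)]

end StayLower

/-! ### Staying in an open set, read off countably many times -/

section Countable

/-- A dense sequence of times in the unit interval. -/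
noncomputable def unitTimes (j : ℕ) : ℝ≥0 := (TopologicalSpace.denseSeq (Set.Iic (1 : ℝ≥0)) j : ℝ≥0)

lemma unitTimes_le (j : ℕ) : unitTimes j ≤ 1 := (TopologicalSpace.denseSeq (Set.Iic (1 : ℝ≥0)) j).2

lemma forall_mem_of_unitTimes {E : Type*} [TopologicalSpace E] {w : ℝ≥0 → E} (hw : Continuous w)
    {s : ℝ≥0} {C : Set E} (hC : IsClosed C) (h : ∀ j, w (s * unitTimes j) ∈ C) :
    ∀ u ≤ s, w u ∈ C := by
  intro u hu
  have h1 : IsClosed {v : Set.Iic (1 : ℝ≥0) | w (s * v) ∈ C} :=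
    hC.preimage (by fun_prop)
  have h2 : Set.range (TopologicalSpace.denseSeq (Set.Iic (1 : ℝ≥0))) ⊆
      {v : Set.Iic (1 : ℝ≥0) | w (s * v) ∈ C} := by
    rintro _ ⟨j, rfl⟩
    exact h j
  have h3 := (TopologicalSpace.denseRange_denseSeq (Set.Iic (1 : ℝ≥0))).closure_range.symm.subset.trans
    (closure_minimal h2 h1) (Set.mem_univ ⟨u / s, div_le_one_of_le₀ hu zero_le⟩)
  rcases eq_or_ne s 0 with rfl | hs
  · have : u = 0 := le_antisymm hu zero_le
    subst this
    simpa using h 0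
  · have h4 : w (s * (u / s)) ∈ C := h3
    rwa [mul_div_cancel₀ u hs] at h4

/-- The sequences that keep a positive distance from the complement of `D`. -/
def staySeq {E : Type*} [PseudoMetricSpace E] (D : Set E) : Set (ℕ → E) :=
  ⋃ k : ℕ, ⋂ j : ℕ, (fun p : ℕ → E => p j) ⁻¹' (Metric.thickening (1 / ((k : ℝ) + 1)) Dᶜ)ᶜ

lemma measurableSet_staySeq {E : Type*} [PseudoMetricSpace E] [MeasurableSpace E]
    [OpensMeasurableSpace E] (D : Set E) : MeasurableSet (staySeq D) :=
  MeasurableSet.iUnion fun _ => MeasurableSet.iInter fun j =>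
    Metric.isOpen_thickening.measurableSet.compl.preimage (measurable_pi_apply j)

/-- The path over [0,s] is compact, so inside the open set D it keeps a positive distance from the
complement, and this closed condition can be tested on dense times. Membership in D at dense times
alone would not suffice. Laws and independence can then be applied to a measurable event in sequence
space. -/
lemma forall_mem_iff_mem_staySeq {E : Type*} [PseudoMetricSpace E] {D : Set E} (hD : IsOpen D)
    {w : ℝ≥0 → E} (hw : Continuous w) (s : ℝ≥0) :
    (∀ u ≤ s, w u ∈ D) ↔ (fun j => w (s * unitTimes j)) ∈ staySeq D := by
  simp only [staySeq, Set.mem_iUnion, Set.mem_iInter, Set.mem_preimage]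
  constructor
  · intro h
    have hK : IsCompact (w '' Set.Icc 0 s) := isCompact_Icc.image hw
    have hdisj : Disjoint (w '' Set.Icc 0 s) Dᶜ := by
      rw [Set.disjoint_left]
      rintro _ ⟨u, hu, rfl⟩ h'
      exact h' (h u hu.2)
    obtain ⟨δ, hδ, hd⟩ := hdisj.exists_thickenings hK hD.isClosed_compl
    obtain ⟨k, hk⟩ := exists_nat_one_div_lt hδ
    refine ⟨k, fun j hj => ?_⟩
    have hle : s * unitTimes j ≤ s := mul_le_of_le_one_right zero_le (unitTimes_le j)
    exact Set.disjoint_left.1 hd (Metric.self_subset_thickening hδ _ ⟨_, ⟨zero_le, hle⟩, rfl⟩)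
      (Metric.thickening_mono hk.le _ hj)
  · rintro ⟨k, hk⟩ u hu
    have := forall_mem_of_unitTimes hw Metric.isOpen_thickening.isClosed_compl hk u hu
    by_contra hc
    exact this (Metric.self_subset_thickening (by positivity) _ hc)

end Countable

/-! ### Equality of laws and independence for the stay events -/

section Law

variable {Ω Ω' : Type*} [MeasurableSpace Ω] [MeasurableSpace Ω'] {P : Measure Ω} {P' : Measure Ω'}

lemma map_sequence_eq_of_isPreBrownianReal [IsProbabilityMeasure P] [IsProbabilityMeasure P']
    {B : ℝ≥0 → Ω → ℝ} {B' : ℝ≥0 → Ω' → ℝ} (hB : IsPreBrownianReal B P)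
    (hB' : IsPreBrownianReal B' P') (t : ℕ → ℝ≥0) :
    P.map (fun ω j => B (t j) ω) = P'.map (fun ω j => B' (t j) ω) := by
  classical
  have key : ∀ I : Finset ℕ, P.map (fun ω => I.restrict (fun j => B (t j) ω)) =
      P'.map (fun ω => I.restrict (fun j => B' (t j) ω)) := by
    intro I
    -- The times `t j` may repeat, so the finite-dimensional law is taken over the image of `I` and
    -- pulled back to the indices.
    set g : (I.image t → ℝ) → (I → ℝ) := fun x j => x ⟨t j, Finset.mem_image_of_mem t j.2⟩ with hg
    have hgm : Measurable g := by fun_prop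
    have h1 := hB.hasLaw (I.image t)
    have h2 := hB'.hasLaw (I.image t)
    have e1 : P.map (fun ω => I.restrict (fun j => B (t j) ω)) =
        (P.map (fun ω => (I.image t).restrict (B · ω))).map g := by
      rw [AEMeasurable.map_map_of_aemeasurable hgm.aemeasurable h1.aemeasurable]
      rfl
    have e2 : P'.map (fun ω => I.restrict (fun j => B' (t j) ω)) =
        (P'.map (fun ω => (I.image t).restrict (B' · ω))).map g := by
      rw [AEMeasurable.map_map_of_aemeasurable hgm.aemeasurable h2.aemeasurable]
      rfl
    rw [e1, e2, h1.map_eq, h2.map_eq]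
  have hm : AEMeasurable (fun ω j => B (t j) ω) P := aemeasurable_pi_lambda _ fun _ => hB.aemeasurable _
  have hm' : AEMeasurable (fun ω j => B' (t j) ω) P' :=
    aemeasurable_pi_lambda _ fun _ => hB'.aemeasurable _
  have l1 := isProjectiveLimit_map (X := fun j ω => B (t j) ω) hm
  have l2 := isProjectiveLimit_map (X := fun j ω => B' (t j) ω) hm'
  simp_rw [key] at l1
  have (I : Finset ℕ) : IsFiniteMeasure (P'.map (fun ω => I.restrict (fun j => B' (t j) ω))) :=
    inferInstance
  exact l1.unique l2

lemma IsBrownian.ae_continuous {n : ℕ} {B : ℝ≥0 → Ω → EuclideanSpace ℝ (Fin n)}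
    (hB : IsBrownian B P) : ∀ᵐ ω ∂P, Continuous fun t => B t ω := by
  filter_upwards [ae_all_iff.2 fun i => (hB.coord i).cont] with ω hω
  have : Continuous fun t => WithLp.toLp 2 fun i => B t ω i :=
    (PiLp.continuous_toLp 2 _).comp (continuous_pi hω)
  exact this

lemma IsBrownian.ae_zero {n : ℕ} {B : ℝ≥0 → Ω → EuclideanSpace ℝ (Fin n)}
    (hB : IsBrownian B P) : ∀ᵐ ω ∂P, B 0 ω = 0 := by
  filter_upwards [ae_all_iff.2 fun i => (hB.coord i).eval_zero_ae_eq_zero] with ω hω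
  ext i
  exact hω i

lemma map_sequence_eq_of_isBrownian [IsProbabilityMeasure P] [IsProbabilityMeasure P'] {n : ℕ}
    {B : ℝ≥0 → Ω → EuclideanSpace ℝ (Fin n)} {B' : ℝ≥0 → Ω' → EuclideanSpace ℝ (Fin n)}
    (hB : IsBrownian B P) (hB' : IsBrownian B' P') (t : ℕ → ℝ≥0) :
    P.map (fun ω j => B (t j) ω) = P'.map (fun ω j => B' (t j) ω) := by
  set Φ : (Fin n → ℕ → ℝ) → ℕ → EuclideanSpace ℝ (Fin n) := fun v j =>
    WithLp.toLp 2 fun i => v i j with hΦ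
  have hΦm : Measurable Φ := by
    refine measurable_pi_lambda _ fun j => ?_
    exact (WithLp.measurable_toLp 2 _).comp (by fun_prop)
  have hψ : Measurable fun (w : ℝ≥0 → ℝ) (j : ℕ) => w (t j) :=
    measurable_pi_lambda _ fun j => measurable_pi_apply (t j)
  have hV : ∀ i, AEMeasurable (fun ω (j : ℕ) => B (t j) ω i) P := fun i =>
    aemeasurable_pi_lambda _ fun j => (hB.coord i).aemeasurable _
  have hV' : ∀ i, AEMeasurable (fun ω (j : ℕ) => B' (t j) ω i) P' := fun i =>
    aemeasurable_pi_lambda _ fun j => (hB'.coord i).aemeasurable _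
  have h1 : iIndepFun (fun (i : Fin n) ω (j : ℕ) => B (t j) ω i) P :=
    hB.indep.comp (fun _ w j => w (t j)) fun _ => hψ
  have h1' : iIndepFun (fun (i : Fin n) ω (j : ℕ) => B' (t j) ω i) P' :=
    hB'.indep.comp (fun _ w j => w (t j)) fun _ => hψ
  rw [iIndepFun_iff_map_fun_eq_pi_map hV] at h1
  rw [iIndepFun_iff_map_fun_eq_pi_map hV'] at h1'
  have h2 : P.map (fun ω (i : Fin n) (j : ℕ) => B (t j) ω i) =
      P'.map (fun ω (i : Fin n) (j : ℕ) => B' (t j) ω i) := by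
    rw [h1, h1']
    congr 1
    ext1 i
    exact map_sequence_eq_of_isPreBrownianReal (hB.coord i).toIsPreBrownianReal
      (hB'.coord i).toIsPreBrownianReal t
  have e : P.map (fun ω j => B (t j) ω) =
      (P.map (fun ω (i : Fin n) (j : ℕ) => B (t j) ω i)).map Φ := by
    rw [AEMeasurable.map_map_of_aemeasurable hΦm.aemeasurable (aemeasurable_pi_lambda _ hV)]
    rfl
  have e' : P'.map (fun ω j => B' (t j) ω) =
      (P'.map (fun ω (i : Fin n) (j : ℕ) => B' (t j) ω i)).map Φ := by
    rw [AEMeasurable.map_map_of_aemeasurable hΦm.aemeasurable (aemeasurable_pi_lambda _ hV')]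
    rfl
  rw [e, e', h2]

lemma IsBrownian.aemeasurable {n : ℕ} {B : ℝ≥0 → Ω → EuclideanSpace ℝ (Fin n)}
    (hB : IsBrownian B P) (t : ℝ≥0) : AEMeasurable (B t) P :=
  (WithLp.measurable_toLp 2 _).comp_aemeasurable
    (aemeasurable_pi_lambda (fun ω i => B t ω i) fun i => (hB.coord i).aemeasurable t)

/-- The event that the path `z + B` stays in `D` on `[0, s]`. -/
def stay {Ω E : Type*} [Add E] (B : ℝ≥0 → Ω → E) (z : E) (D : Set E) (s : ℝ≥0) : Set Ω :=
  {ω | ∀ u ≤ s, z + B u ω ∈ D}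

lemma measurableSet_preimage_staySeq {E : Type*} [NormedAddCommGroup E] [MeasurableSpace E]
    [BorelSpace E] [SecondCountableTopology E] (z : E) (D : Set E) :
    MeasurableSet ((fun (p : ℕ → E) j => z + p j) ⁻¹' staySeq D) := by
  refine (measurableSet_staySeq D).preimage (measurable_pi_lambda _ fun j => ?_)
  have h : Measurable fun p : ℕ → E => p j := measurable_pi_apply j
  exact h.const_add z

lemma stay_ae_eq {n : ℕ} {B : ℝ≥0 → Ω → EuclideanSpace ℝ (Fin n)}
    (hB : IsBrownian B P) (z : EuclideanSpace ℝ (Fin n)) {D : Set (EuclideanSpace ℝ (Fin n))}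
    (hD : IsOpen D) (s : ℝ≥0) :
    stay B z D s =ᵐ[P] (fun ω j => B (s * unitTimes j) ω) ⁻¹'
      ((fun (p : ℕ → EuclideanSpace ℝ (Fin n)) j => z + p j) ⁻¹' staySeq D) := by
  filter_upwards [hB.ae_continuous] with ω hω
  have := forall_mem_iff_mem_staySeq hD (w := fun t => z + B t ω) (by fun_prop) s
  exact propext this

/-- Carries the hypothesis on the given Brownian motion over to `Xp` and `Xm`, which live on another
space. -/
lemma measure_stay_eq [IsProbabilityMeasure P] [IsProbabilityMeasure P'] {n : ℕ}
    {B : ℝ≥0 → Ω → EuclideanSpace ℝ (Fin n)} {B' : ℝ≥0 → Ω' → EuclideanSpace ℝ (Fin n)}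
    (hB : IsBrownian B P) (hB' : IsBrownian B' P') (z : EuclideanSpace ℝ (Fin n))
    {D : Set (EuclideanSpace ℝ (Fin n))} (hD : IsOpen D) (s : ℝ≥0) :
    P (stay B z D s) = P' (stay B' z D s) := by
  have hm := measurableSet_preimage_staySeq z D
  rw [measure_congr (stay_ae_eq hB z hD s), measure_congr (stay_ae_eq hB' z hD s),
    ← Measure.map_apply_of_aemeasurable (aemeasurable_pi_lambda _ fun j => hB.aemeasurable _) hm,
    ← Measure.map_apply_of_aemeasurable (aemeasurable_pi_lambda _ fun j => hB'.aemeasurable _) hm,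
    map_sequence_eq_of_isBrownian hB hB']

lemma measure_stay_inter_stay_inter {n : ℕ} [IsProbabilityMeasure P]
    {Xp Xm : ℝ≥0 → Ω → EuclideanSpace ℝ (Fin n)} {Y : ℝ≥0 → Ω → ℝ}
    (hXp : IsBrownian Xp P) (hXm : IsBrownian Xm P) (hY : IsBrownianReal Y P)
    (hXX : IndepFun (fun (ω : Ω) (t : ℝ≥0) => Xp t ω) (fun (ω : Ω) (t : ℝ≥0) => Xm t ω) P)
    (hXY : IndepFun (fun ω : Ω => ((fun t : ℝ≥0 => Xp t ω), (fun t : ℝ≥0 => Xm t ω)))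
      (fun (ω : Ω) (t : ℝ≥0) => Y t ω) P)
    (z : EuclideanSpace ℝ (Fin n)) {D : Set (EuclideanSpace ℝ (Fin n))} (hD : IsOpen D)
    (r s T : ℝ≥0) {I : Set ℝ} (hI : IsClosed I) :
    P.real (stay Xp z D r ∩ stay Xm z D s ∩ {ω | ∀ u ≤ T, Y u ω ∈ I}) =
      P.real (stay Xp z D r) * P.real (stay Xm z D s) * P.real {ω | ∀ u ≤ T, Y u ω ∈ I} := by
  set S := (fun (p : ℕ → EuclideanSpace ℝ (Fin n)) j => z + p j) ⁻¹' staySeq D with hS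
  have hSm : MeasurableSet S := measurableSet_preimage_staySeq z D
  have hψ : ∀ r : ℝ≥0, Measurable fun (w : ℝ≥0 → EuclideanSpace ℝ (Fin n)) (j : ℕ) =>
      w (r * unitTimes j) := fun r => measurable_pi_lambda _ fun j => measurable_pi_apply _
  set F : Set (ℝ≥0 → ℝ) := ⋂ j : ℕ, (fun w => w (T * unitTimes j)) ⁻¹' I with hF
  have hFm : MeasurableSet F := MeasurableSet.iInter fun j =>
    hI.measurableSet.preimage (measurable_pi_apply _)
  have e1 := stay_ae_eq hXp z hD r
  have e2 := stay_ae_eq hXm z hD s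
  have e3 : {ω | ∀ u ≤ T, Y u ω ∈ I} =ᵐ[P] (fun ω t => Y t ω) ⁻¹' F := by
    filter_upwards [hY.cont] with ω hω
    refine propext ⟨fun h => Set.mem_iInter.2 fun j =>
      h _ (mul_le_of_le_one_right zero_le (unitTimes_le j)), fun h => ?_⟩
    exact forall_mem_of_unitTimes hω hI fun j => Set.mem_iInter.1 h j
  rw [measureReal_congr ((e1.inter e2).inter e3), measureReal_congr e1, measureReal_congr e2,
    measureReal_congr e3]
  have i1 := hXX.measure_inter_preimage_eq_mul _ _ (hSm.preimage (hψ r)) (hSm.preimage (hψ s))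
  have i2 := hXY.measure_inter_preimage_eq_mul _ _
    ((hSm.preimage (hψ r)).prod (hSm.preimage (hψ s))) hFm
  have i3 : P ((fun ω j => Xp (r * unitTimes j) ω) ⁻¹' S ∩
      (fun ω j => Xm (s * unitTimes j) ω) ⁻¹' S ∩ (fun ω t => Y t ω) ⁻¹' F) =
      P ((fun ω j => Xp (r * unitTimes j) ω) ⁻¹' S) *
      P ((fun ω j => Xm (s * unitTimes j) ω) ⁻¹' S) * P ((fun ω t => Y t ω) ⁻¹' F) := by
    refine Eq.trans i2 ?_
    congr 1
  rw [measureReal_def, i3, ENNReal.toReal_mul, ENNReal.toReal_mul]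
  rfl

end Law

/-! ### From the exit time of the iterated motion to its three driving motions -/

section Exit

lemma lt_exitTime_iff {Ω E : Type*} [TopologicalSpace E] {Z : ℝ≥0 → Ω → E} {D : Set E}
    (hD : IsOpen D) {ω : Ω} (hZ : Continuous fun s => Z s ω) (t : ℝ≥0) :
    (t : WithTop ℝ≥0) < exitTime Z D ω ↔ ∀ s ≤ t, Z s ω ∈ D := by
  constructor
  · intro h s hs
    have hs' : (s : WithTop ℝ≥0) ≤ t := WithTop.coe_le_coe.2 hs
    exact not_not.1 (notMem_of_lt_hittingAfter (hs'.trans_lt h) zero_le)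
  · intro h
    by_cases hex : ∃ j, 0 ≤ j ∧ Z j ω ∈ Dᶜ
    · rw [exitTime, hittingAfter, if_pos hex, WithTop.coe_lt_coe]
      by_contra hc
      have hcl : IsClosed {i : ℝ≥0 | 0 ≤ i ∧ Z i ω ∈ Dᶜ} := by
        simp only [zero_le, true_and]
        exact hD.isClosed_compl.preimage hZ
      -- The set of times outside D is closed, so its infimum is attained; hence the strict
      -- inequality matches the closed time range s ≤ t.
      have hmem := hcl.csInf_mem hex (OrderBot.bddBelow _)
      exact hmem.2 (h _ (not_lt.1 hc))
    · rw [exitTime, hittingAfter, if_neg hex]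
      exact WithTop.coe_lt_top t

lemma continuous_iterated {Ω E : Type*} [TopologicalSpace E] [AddGroup E] [ContinuousAdd E] (z : E)
    {Xp Xm : ℝ≥0 → Ω → E} {Y : ℝ≥0 → Ω → ℝ} {ω : Ω} (hp : Continuous fun t => Xp t ω)
    (hm : Continuous fun t => Xm t ω) (hy : Continuous fun t => Y t ω) (hp0 : Xp 0 ω = 0)
    (hm0 : Xm 0 ω = 0) : Continuous fun t => iterated z Xp Xm Y t ω := by
  have h : Continuous fun t : ℝ => twoSided Xp Xm t ω := by
    unfold twoSided
    refine Continuous.if_le (hp.comp continuous_real_toNNReal)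
      (hm.comp (continuous_real_toNNReal.comp continuous_neg)) continuous_const continuous_id ?_
    rintro x rfl
    simp [hp0, hm0]
  exact continuous_const.add (h.comp hy)

/-- M and -m are the maximum and minimum of Y on [0,t]. By the intermediate value theorem Y takes
every value between them, so Z visits all of the corresponding two-sided path. -/
lemma exists_range_of_stay_iterated {Ω E : Type*} [Add E] {Xp Xm : ℝ≥0 → Ω → E}
    {Y : ℝ≥0 → Ω → ℝ} (z : E) {D : Set E} {ω : Ω} (hy : Continuous fun t => Y t ω) (hy0 : Y 0 ω = 0) (hm0 : Xm 0 ω = Xp 0 ω) {t : ℝ≥0}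
    (h : ∀ s ≤ t, iterated z Xp Xm Y s ω ∈ D) :
    ∃ m M : ℝ≥0, ω ∈ stay Xp z D M ∧ ω ∈ stay Xm z D m ∧
      ∀ s ≤ t, Y s ω ∈ Set.Icc (-m : ℝ) M := by
  have hK : IsCompact (Set.Icc 0 t) := isCompact_Icc
  have h0 : (0 : ℝ≥0) ∈ Set.Icc 0 t := ⟨le_rfl, zero_le⟩
  obtain ⟨u, hu, hu'⟩ := hK.exists_isMaxOn ⟨0, h0⟩ hy.continuousOn
  obtain ⟨l, hl, hl'⟩ := hK.exists_isMinOn ⟨0, h0⟩ hy.continuousOn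
  have hu0 : 0 ≤ Y u ω := by have := hu' h0; simpa [hy0] using this
  have hl0 : Y l ω ≤ 0 := by have := hl' h0; simpa [hy0] using this
  have hpre : IsPreconnected (Set.Icc 0 t) := isPreconnected_Icc
  refine ⟨(-Y l ω).toNNReal, (Y u ω).toNNReal, fun v hv => ?_, fun v hv => ?_, fun s hs => ?_⟩
  · have hv' : (v : ℝ) ≤ Y u ω := by
      rwa [← NNReal.coe_le_coe, Real.coe_toNNReal _ hu0] at hv
    obtain ⟨s, hs, hsv⟩ := hpre.intermediate_value h0 hu hy.continuousOn
      (show (v : ℝ) ∈ Set.Icc (Y 0 ω) (Y u ω) from ⟨by rw [hy0]; exact v.coe_nonneg, hv'⟩)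
    have := h s hs.2
    unfold iterated twoSided at this
    simp only at hsv
    rw [hsv, if_pos v.coe_nonneg, Real.toNNReal_coe] at this
    exact this
  · have hv' : (v : ℝ) ≤ -Y l ω := by
      rwa [← NNReal.coe_le_coe, Real.coe_toNNReal _ (by linarith)] at hv
    obtain ⟨s, hs, hsv⟩ := hpre.intermediate_value hl h0 hy.continuousOn
      (show (-v : ℝ) ∈ Set.Icc (Y l ω) (Y 0 ω) from
        ⟨by linarith, by rw [hy0, neg_nonpos]; exact v.coe_nonneg⟩)
    have := h s hs.2
    unfold iterated twoSided at this
    simp only at hsv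
    rw [hsv] at this
    -- At time 0 the two-sided path uses the forward branch, hence the need for `hm0`.
    rcases eq_or_ne v 0 with rfl | hv0
    · simpa [hm0] using this
    · have : ¬ (0 : ℝ) ≤ -v := by
        have : (0 : ℝ) < v := by positivity
        linarith
      rwa [if_neg this, neg_neg, Real.toNNReal_coe] at *
  · have h1 := hu' (show s ∈ Set.Icc 0 t from ⟨zero_le, hs⟩)
    have h2 := hl' (show s ∈ Set.Icc 0 t from ⟨zero_le, hs⟩)
    simp only [Set.mem_ofPred_eq] at h1 h2
    rw [Real.coe_toNNReal _ hu0, Real.coe_toNNReal _ (by linarith), neg_neg]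
    exact ⟨h2, h1⟩

variable {Ω : Type*} [MeasurableSpace Ω] {P : Measure Ω} {n : ℕ}

lemma setOf_lt_exitTime_ae_eq {B : ℝ≥0 → Ω → EuclideanSpace ℝ (Fin n)} (hB : IsBrownian B P)
    (z : EuclideanSpace ℝ (Fin n)) {D : Set (EuclideanSpace ℝ (Fin n))} (hD : IsOpen D) (t : ℝ≥0) :
    {ω | (t : WithTop ℝ≥0) < exitTime (fun s ω => z + B s ω) D ω} =ᵐ[P] stay B z D t := by
  filter_upwards [hB.ae_continuous] with ω hω
  exact propext (lt_exitTime_iff (Z := fun s ω => z + B s ω) hD (by fun_prop) t)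

variable {Xp Xm : ℝ≥0 → Ω → EuclideanSpace ℝ (Fin n)} {Y : ℝ≥0 → Ω → ℝ}
  (z : EuclideanSpace ℝ (Fin n)) {D : Set (EuclideanSpace ℝ (Fin n))}

lemma ae_lt_exitTime_iterated_iff (hXp : IsBrownian Xp P) (hXm : IsBrownian Xm P)
    (hY : IsBrownianReal Y P) (hD : IsOpen D) (t : ℝ≥0) :
    ∀ᵐ ω ∂P, (t : WithTop ℝ≥0) < exitTime (iterated z Xp Xm Y) D ω ↔
      ∀ s ≤ t, iterated z Xp Xm Y s ω ∈ D := by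
  filter_upwards [hXp.ae_continuous, hXm.ae_continuous, hY.cont, hXp.ae_zero, hXm.ae_zero] with
    ω h1 h2 h3 h4 h5
  exact lt_exitTime_iff hD (continuous_iterated z h1 h2 h3 h4 h5) t

lemma le_measureReal_lt_exitTime_iterated [IsProbabilityMeasure P] (hXp : IsBrownian Xp P)
    (hXm : IsBrownian Xm P) (hY : IsBrownianReal Y P)
    (hXX : IndepFun (fun (ω : Ω) (t : ℝ≥0) => Xp t ω) (fun (ω : Ω) (t : ℝ≥0) => Xm t ω) P)
    (hXY : IndepFun (fun ω : Ω => ((fun t : ℝ≥0 => Xp t ω), (fun t : ℝ≥0 => Xm t ω)))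
      (fun (ω : Ω) (t : ℝ≥0) => Y t ω) P) (hD : IsOpen D) (t a b : ℝ≥0) :
    P.real (stay Xp z D b) * P.real (stay Xm z D a) *
        P.real {ω | ∀ u ≤ t, Y u ω ∈ Set.Icc (-a : ℝ) b} ≤
      P.real {ω | (t : WithTop ℝ≥0) < exitTime (iterated z Xp Xm Y) D ω} := by
  rw [← measure_stay_inter_stay_inter hXp hXm hY hXX hXY z hD b a t isClosed_Icc]
  refine ENNReal.toReal_mono (measure_ne_top P _) (measure_mono_ae ?_)
  filter_upwards [ae_lt_exitTime_iterated_iff z hXp hXm hY hD t] with ω hω hmem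
  obtain ⟨⟨h1, h2⟩, h3⟩ := hmem
  refine hω.2 fun s hs => ?_
  obtain ⟨h4, h5⟩ := h3 s hs
  unfold iterated twoSided
  split_ifs with h
  · exact h1 _ (Real.toNNReal_le_iff_le_coe.2 h5)
  · exact h2 _ (Real.toNNReal_le_iff_le_coe.2 (by linarith))

lemma stay_anti {Ω E : Type*} [Add E] (B : ℝ≥0 → Ω → E) (z : E) (D : Set E) {r s : ℝ≥0}
    (h : r ≤ s) : stay B z D s ⊆ stay B z D r :=
  fun _ hω u hu => hω u (hu.trans h)

/-- Either M or m reaches N d, or (M, m) lies in one of N² cells of side d. In a cell, M and m are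
rounded down for the two stay events and up for the interval confining Y, so that the three events
are independent. -/
lemma measureReal_lt_exitTime_iterated_le [IsProbabilityMeasure P] (hXp : IsBrownian Xp P)
    (hXm : IsBrownian Xm P) (hY : IsBrownianReal Y P)
    (hXX : IndepFun (fun (ω : Ω) (t : ℝ≥0) => Xp t ω) (fun (ω : Ω) (t : ℝ≥0) => Xm t ω) P)
    (hXY : IndepFun (fun ω : Ω => ((fun t : ℝ≥0 => Xp t ω), (fun t : ℝ≥0 => Xm t ω)))
      (fun (ω : Ω) (t : ℝ≥0) => Y t ω) P) (hD : IsOpen D) (t : ℝ≥0) {d : ℝ≥0} (hd : d ≠ 0)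
    (N : ℕ) :
    P.real {ω | (t : WithTop ℝ≥0) < exitTime (iterated z Xp Xm Y) D ω} ≤
      P.real (stay Xp z D (N * d)) + P.real (stay Xm z D (N * d)) +
      ∑ q ∈ Finset.range N ×ˢ Finset.range N,
        P.real (stay Xp z D (q.1 * d)) * P.real (stay Xm z D (q.2 * d)) *
          P.real {ω | ∀ u ≤ t, Y u ω ∈ Set.Icc (-((q.2 + 1) * d) : ℝ) ((q.1 + 1) * d)} := by
  set T : ℕ × ℕ → Set Ω := fun q => stay Xp z D (q.1 * d) ∩ stay Xm z D (q.2 * d) ∩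
    {ω | ∀ u ≤ t, Y u ω ∈ Set.Icc (-((q.2 + 1) * d) : ℝ) ((q.1 + 1) * d)} with hT
  have hsub : {ω | (t : WithTop ℝ≥0) < exitTime (iterated z Xp Xm Y) D ω} ≤ᵐ[P]
      ((stay Xp z D (N * d) ∪ stay Xm z D (N * d)) ∪
        ⋃ q ∈ Finset.range N ×ˢ Finset.range N, T q : Set Ω) := by
    filter_upwards [ae_lt_exitTime_iterated_iff z hXp hXm hY hD t, hY.cont, hXp.ae_zero,
      hXm.ae_zero, hY.eval_zero_ae_eq_zero] with ω hω hy hp0 hm0 hy0 hmem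
    obtain ⟨m, M, h1, h2, h3⟩ := exists_range_of_stay_iterated z hy hy0 (hm0.trans hp0.symm)
      (hω.1 hmem)
    by_cases hM : N * d ≤ M
    · exact Or.inl (Or.inl (stay_anti _ _ _ hM h1))
    by_cases hm : N * d ≤ m
    · exact Or.inl (Or.inr (stay_anti _ _ _ hm h2))
    have hd' : 0 < d := pos_iff_ne_zero.2 hd
    refine Or.inr (Set.mem_iUnion₂.2 ⟨(⌊M / d⌋₊, ⌊m / d⌋₊), ?_, ⟨⟨?_, ?_⟩, fun u hu => ?_⟩⟩)
    · rw [Finset.mem_product, Finset.mem_range, Finset.mem_range, Nat.floor_lt zero_le,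
        Nat.floor_lt zero_le, div_lt_iff₀ hd', div_lt_iff₀ hd']
      exact ⟨not_le.1 hM, not_le.1 hm⟩
    · refine stay_anti _ _ _ ?_ h1
      rw [← le_div_iff₀ hd']
      exact Nat.floor_le zero_le
    · refine stay_anti _ _ _ ?_ h2
      rw [← le_div_iff₀ hd']
      exact Nat.floor_le zero_le
    · obtain ⟨h4, h5⟩ := h3 u hu
      have h6 : M ≤ (⌊M / d⌋₊ + 1) * d := by
        rw [← div_le_iff₀ hd']; exact (Nat.lt_floor_add_one _).le
      have h7 : m ≤ (⌊m / d⌋₊ + 1) * d := by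
        rw [← div_le_iff₀ hd']; exact (Nat.lt_floor_add_one _).le
      rw [← NNReal.coe_le_coe] at h6 h7
      push_cast at h6 h7
      exact ⟨by linarith, by linarith⟩
  calc _ ≤ P.real ((stay Xp z D (N * d) ∪ stay Xm z D (N * d)) ∪
        ⋃ q ∈ Finset.range N ×ˢ Finset.range N, T q : Set Ω) :=
        ENNReal.toReal_mono (measure_ne_top P _) (measure_mono_ae hsub)
    _ ≤ P.real (stay Xp z D (N * d)) + P.real (stay Xm z D (N * d)) +
        ∑ q ∈ Finset.range N ×ˢ Finset.range N, P.real (T q) := by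
        refine (measureReal_union_le _ _).trans ?_
        gcongr
        · exact measureReal_union_le _ _
        · exact measureReal_biUnion_finset_le _ _
    _ = _ := by
        congr 1
        refine Finset.sum_congr rfl fun q _ => ?_
        exact measure_stay_inter_stay_inter hXp hXm hY hXX hXY z hD _ _ t isClosed_Icc

lemma exists_forall_measureReal_scaled_le {a b lam : ℝ} (ha : 0 ≤ a) (hb : 0 ≤ b) (hab : 0 < a + b)
    (hlam : lam < Real.pi ^ 2 / (2 * (a + b) ^ 2)) :
    ∃ C : ℝ, 0 < C ∧ ∀ {Ω : Type*} [MeasurableSpace Ω] (P : Measure Ω) [IsProbabilityMeasure P]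
      (Y : ℝ≥0 → Ω → ℝ), IsPreBrownianReal Y P → ∀ t x : ℝ≥0, x ≠ 0 →
        P.real {ω | ∀ s ≤ t, Y s ω ∈ Set.Icc (-(a * x)) (b * x)} ≤
          C * Real.exp (-(lam * (t / x ^ 2))) := by
  obtain ⟨C, hC0, hC⟩ := exists_forall_measureReal_le ha hb hab hlam
  refine ⟨C, hC0, fun P _ Y hY t x hx => ?_⟩
  have hx' : (0 : ℝ) < x := by positivity
  -- Brownian scaling: s ↦ Y(x² s)/x is again Brownian, and C is the same for all x.
  have h1 := hC P _ (hY.smul (c := x ^ 2) (by positivity)) (t / x ^ 2)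
  push_cast at h1
  refine (measureReal_mono ?_).trans h1
  intro ω hω s hs
  have hst : x ^ 2 * s ≤ t := by
    rw [le_div_iff₀ (by positivity)] at hs
    rwa [mul_comm]
  obtain ⟨h2, h3⟩ := hω _ hst
  rw [Real.sqrt_sq hx'.le, inv_mul_eq_div]
  refine ⟨?_, ?_⟩
  · rw [le_div_iff₀ hx']; linarith
  · rw [div_le_iff₀ hx']; linarith

end Exit

/-! ### The minimisation that produces the constant -/

section Variational

/-- The rate constant, which is the minimum of `u ↦ c * u ^ β + π ^ 2 / (2 * u ^ 2)`. -/
noncomputable def rate (β c : ℝ) : ℝ :=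
  (2 + β) / 2 * c ^ (2 / (2 + β)) * β ^ (-(β / (2 + β))) * Real.pi ^ (2 * β / (2 + β))

lemma exists_rate_eq {β c : ℝ} (hβ : 0 < β) (hc : 0 < c) :
    ∃ K : ℝ, 0 < K ∧ rate β c = c * K ^ β * (1 + β / 2) ∧ Real.pi ^ 2 = c * β * K ^ β * K ^ 2 := by
  have hπ := Real.pi_pos
  -- The critical point of u ↦ c u^β + π²/(2u²), where c β u^(β+2) = π².
  set K := (Real.pi ^ 2 / (c * β)) ^ (1 / (2 + β)) with hK
  have hK0 : 0 < K := by positivity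
  have h1 : Real.pi ^ 2 = c * β * K ^ β * K ^ 2 := by
    have : K ^ β * K ^ (2 : ℕ) = Real.pi ^ 2 / (c * β) := by
      rw [← Real.rpow_natCast, ← Real.rpow_add hK0, hK, ← Real.rpow_mul (by positivity)]
      rw [show 1 / (2 + β) * (β + (2 : ℕ)) = 1 by push_cast; field_simp; ring, Real.rpow_one]
    rw [mul_assoc, this]
    field_simp
  refine ⟨K, hK0, ?_, h1⟩
  have h2 : Real.pi ^ (2 * β / (2 + β)) = c ^ (β / (2 + β)) * β ^ (β / (2 + β)) * K ^ β := by
    rw [mul_div_assoc, Real.rpow_mul hπ.le, Real.rpow_two, h1, mul_assoc, ← Real.rpow_two,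
      ← Real.rpow_add hK0, Real.mul_rpow (by positivity) (by positivity),
      Real.mul_rpow hc.le hβ.le, ← Real.rpow_mul hK0.le]
    congr 2
    field_simp
    ring
  have h3 : β ^ (-(β / (2 + β))) * β ^ (β / (2 + β)) = 1 := by
    rw [← Real.rpow_add hβ]; simp
  have h4 : c ^ (2 / (2 + β)) * c ^ (β / (2 + β)) = c := by
    rw [← Real.rpow_add hc, ← add_div, div_self (by positivity), Real.rpow_one]
  calc rate β c = (2 + β) / 2 * (c ^ (2 / (2 + β)) * c ^ (β / (2 + β))) *
        (β ^ (-(β / (2 + β))) * β ^ (β / (2 + β))) * K ^ β := by rw [rate, h2]; ring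
    _ = _ := by rw [h3, h4]; ring

/-- In the variable l = log(u/K) the right side is c K^β (exp(βl) + (β/2) exp(-2l)). Bounding both
exponentials by their tangents at 0, the linear terms cancel. -/
lemma rate_le {β c : ℝ} (hβ : 0 < β) (hc : 0 < c) {u : ℝ} (hu : 0 < u) :
    rate β c ≤ c * u ^ β + Real.pi ^ 2 / (2 * u ^ 2) := by
  obtain ⟨K, hK, h1, h2⟩ := exists_rate_eq hβ hc
  rw [h1, h2]
  set l := Real.log (u / K) with hl
  have hr : Real.exp l = u / K := Real.exp_log (by positivity)
  have e1 : u ^ β = K ^ β * Real.exp (l * β) := by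
    rw [Real.exp_mul, hr, ← Real.mul_rpow hK.le (by positivity), mul_div_cancel₀ _ hK.ne']
  have e2 : K ^ 2 / u ^ 2 = Real.exp (-(2 * l)) := by
    rw [Real.exp_neg, two_mul, Real.exp_add, hr]
    field_simp
  have e3 : c * β * K ^ β * K ^ 2 / (2 * u ^ 2) = c * K ^ β * (β / 2 * (K ^ 2 / u ^ 2)) := by
    field_simp
  rw [e3, e2, e1]
  have h3 := Real.add_one_le_exp (l * β)
  have h4 := mul_le_mul_of_nonneg_left (Real.add_one_le_exp (-(2 * l))) (by positivity : 0 ≤ β / 2)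
  have : c * K ^ β * (1 + β / 2) ≤
      c * K ^ β * (Real.exp (l * β) + β / 2 * Real.exp (-(2 * l))) :=
    mul_le_mul_of_nonneg_left (by linarith) (by positivity)
  linarith

lemma exists_rate_eq' {β c : ℝ} (hβ : 0 < β) (hc : 0 < c) :
    ∃ K : ℝ, 0 < K ∧ rate β c = c * K ^ β + Real.pi ^ 2 / (2 * K ^ 2) := by
  obtain ⟨K, hK, h1, h2⟩ := exists_rate_eq hβ hc
  refine ⟨K, hK, ?_⟩
  rw [h1, h2]
  field_simp

end Variational

/-! ### Logarithmic asymptotics as exponential bounds -/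

section Asymptotics

variable {ι : Type*} {l : Filter ι}

lemma tendsto_inv_mul_log {S Q : ι → ℝ} {V : ℝ} (hS : Tendsto S l atTop)
    (hlo : ∀ ε > 0, ∀ᶠ t in l, Real.exp (-((V + ε) * S t)) ≤ Q t)
    (hup : ∀ ε > 0, ∀ᶠ t in l, Q t ≤ Real.exp (-((V - ε) * S t))) :
    Tendsto (fun t => (S t)⁻¹ * Real.log (Q t)) l (𝓝 (-V)) := by
  rw [Metric.tendsto_nhds]
  intro ε hε
  filter_upwards [hlo (ε / 2) (by positivity), hup (ε / 2) (by positivity),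
    hS.eventually_gt_atTop 0] with t h1 h2 h3
  have hQ : 0 < Q t := (Real.exp_pos _).trans_le h1
  rw [← Real.le_log_iff_exp_le hQ] at h1
  rw [← Real.log_le_iff_le_exp hQ] at h2
  rw [Real.dist_eq, inv_mul_eq_div, abs_lt]
  constructor
  · have : -(V + ε / 2) ≤ Real.log (Q t) / S t := by rw [le_div_iff₀ h3]; linarith
    linarith
  · have : Real.log (Q t) / S t ≤ -(V - ε / 2) := by rw [div_le_iff₀ h3]; linarith
    linarith

lemma eventually_mul_exp_le {S : ι → ℝ} (hS : Tendsto S l atTop) (C : ℝ) {u v : ℝ} (huv : u < v) :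
    ∀ᶠ t in l, C * Real.exp (-(v * S t)) ≤ Real.exp (-(u * S t)) := by
  have h : Tendsto (fun t => Real.exp ((v - u) * S t)) l atTop :=
    Real.tendsto_exp_atTop.comp (hS.const_mul_atTop (by linarith))
  filter_upwards [h.eventually_ge_atTop C] with t ht
  calc C * Real.exp (-(v * S t)) ≤ Real.exp ((v - u) * S t) * Real.exp (-(v * S t)) := by gcongr
    _ = _ := by rw [← Real.exp_add]; ring_nf

lemma eventually_exp_le_mul_exp {S : ι → ℝ} (hS : Tendsto S l atTop) {C : ℝ} (hC : 0 < C) {u v : ℝ}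
    (huv : u < v) : ∀ᶠ t in l, Real.exp (-(v * S t)) ≤ C * Real.exp (-(u * S t)) := by
  filter_upwards [eventually_mul_exp_le hS C⁻¹ huv] with t ht
  rwa [inv_mul_le_iff₀ hC] at ht

variable {β c : ℝ} {p : ℝ≥0 → ℝ}

lemma eventually_le_exp (hβ : 0 < β) (hp1 : ∀ t, p t ≤ 1)
    (hp : Tendsto (fun t : ℝ≥0 => (t : ℝ) ^ (-β) * Real.log (p t)) atTop (𝓝 (-c)))
    {x : ι → ℝ≥0} (hx : Tendsto x l atTop) (κ : ℝ≥0) {ε : ℝ} (hε : 0 < ε) :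
    ∀ᶠ t in l, p (κ * x t) ≤ Real.exp (-((c * (κ : ℝ) ^ β - ε) * (x t : ℝ) ^ β)) := by
  -- The case κ = 0 is needed for grid cells touching the origin; there p ≤ 1 suffices.
  rcases eq_or_ne κ 0 with rfl | hκ
  · refine Eventually.of_forall fun t => (hp1 _).trans ?_
    rw [NNReal.coe_zero, Real.zero_rpow hβ.ne', mul_zero, zero_sub, neg_mul, neg_neg]
    exact Real.one_le_exp (by positivity)
  have hκ0 : (0 : ℝ) < κ := by positivity
  have hκx : Tendsto (fun t => κ * x t) l atTop := hx.const_mul_atTop (pos_iff_ne_zero.2 hκ)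
  have h1 := (hp.comp hκx).eventually (gt_mem_nhds (show -c < -c + ε / (κ : ℝ) ^ β by
    have : 0 < ε / (κ : ℝ) ^ β := by positivity
    linarith))
  filter_upwards [h1, hx.eventually_gt_atTop 0] with t ht hxt
  have hx0 : (0 : ℝ) < x t := by exact_mod_cast hxt
  refine (Real.le_exp_log _).trans (Real.exp_le_exp.2 ?_)
  simp only [Function.comp, NNReal.coe_mul] at ht
  rw [Real.rpow_neg (by positivity), inv_mul_lt_iff₀ (by positivity),
    Real.mul_rpow hκ0.le hx0.le] at ht
  refine ht.le.trans (le_of_eq ?_)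
  have : (κ : ℝ) ^ β ≠ 0 := by positivity
  field_simp
  ring

lemma eventually_exp_le (hp0 : ∀ t, 0 ≤ p t) (hc : 0 < c)
    (hp : Tendsto (fun t : ℝ≥0 => (t : ℝ) ^ (-β) * Real.log (p t)) atTop (𝓝 (-c)))
    {x : ι → ℝ≥0} (hx : Tendsto x l atTop) {κ : ℝ≥0} (hκ : κ ≠ 0) {ε : ℝ} (hε : 0 < ε) :
    ∀ᶠ t in l, Real.exp (-((c * (κ : ℝ) ^ β + ε) * (x t : ℝ) ^ β)) ≤ p (κ * x t) := by
  have hκ0 : (0 : ℝ) < κ := by positivity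
  have hκx : Tendsto (fun t => κ * x t) l atTop := hx.const_mul_atTop (pos_iff_ne_zero.2 hκ)
  have h1 := (hp.comp hκx).eventually (lt_mem_nhds (show -c - ε / (κ : ℝ) ^ β < -c by
    have : 0 < ε / (κ : ℝ) ^ β := by positivity
    linarith))
  have h2 := (hp.comp hκx).eventually (gt_mem_nhds (show -c < 0 by linarith))
  filter_upwards [h1, h2, hx.eventually_gt_atTop 0] with t ht ht2 hxt
  have hx0 : (0 : ℝ) < x t := by exact_mod_cast hxt
  -- Since log 0 = 0 by convention, a negative value of the normalised logarithm excludes p = 0.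
  have hpos : 0 < p (κ * x t) := by
    refine lt_of_le_of_ne (hp0 _) fun h => ?_
    simp [← h] at ht2
  rw [← Real.le_log_iff_exp_le hpos]
  simp only [Function.comp, NNReal.coe_mul] at ht
  rw [Real.rpow_neg (by positivity), lt_inv_mul_iff₀ (by positivity),
    Real.mul_rpow hκ0.le hx0.le] at ht
  refine le_trans (le_of_eq ?_) ht.le
  have : (κ : ℝ) ^ β ≠ 0 := by positivity
  field_simp
  ring

end Asymptotics

/-! ### The two bounds at the scale t^(1/(2+β)) -/

section Main

lemma exists_pos_mul_rpow_eq {β c e : ℝ} (hβ : 0 < β) (hc : 0 < c) (he : 0 < e) :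
    ∃ δ : ℝ≥0, δ ≠ 0 ∧ c * (δ : ℝ) ^ β = e := by
  refine ⟨((e / c) ^ (1 / β)).toNNReal, ?_, ?_⟩
  · have : 0 < (e / c) ^ (1 / β) := by positivity
    simpa using this
  · rw [Real.coe_toNNReal _ (by positivity), ← Real.rpow_mul (by positivity), one_div,
      inv_mul_cancel₀ hβ.ne', Real.rpow_one]
    field_simp

lemma rpow_add_add_le {β : ℝ} (hβ0 : 0 < β) (hβ1 : β ≤ 1) {u v w : ℝ} (hu : 0 ≤ u) (hv : 0 ≤ v)
    (hw : 0 ≤ w) : (u + v + w) ^ β ≤ u ^ β + v ^ β + w ^ β :=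
  (Real.rpow_add_le_add_rpow (by positivity) hw hβ0.le hβ1).trans
    (add_le_add_left (Real.rpow_add_le_add_rpow hu hv hβ0.le hβ1) _)

variable {n : ℕ} {β c : ℝ} {D : Set (EuclideanSpace ℝ (Fin n))} {z : EuclideanSpace ℝ (Fin n)}
  {p : ℝ≥0 → ℝ} {Ω : Type*} [MeasurableSpace Ω] {P : Measure Ω} [IsProbabilityMeasure P]
  {Xp Xm : ℝ≥0 → Ω → EuclideanSpace ℝ (Fin n)} {Y : ℝ≥0 → Ω → ℝ}

/-- The spatial scale of the iterated motion at time `t`. -/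
noncomputable def scale (β : ℝ) (t : ℝ≥0) : ℝ≥0 := t ^ (1 / (2 + β))

lemma tendsto_scale (hβ : 0 < β) : Tendsto (scale β) atTop atTop :=
  NNReal.tendsto_rpow_atTop (by positivity)

lemma tendsto_scale_rpow (hβ : 0 < β) : Tendsto (fun t => (scale β t : ℝ) ^ β) atTop atTop :=
  (tendsto_rpow_atTop hβ).comp (NNReal.tendsto_coe_atTop.2 (tendsto_scale hβ))

lemma scale_rpow (β : ℝ) (t : ℝ≥0) : (scale β t : ℝ) ^ β = (t : ℝ) ^ (β / (2 + β)) := by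
  rw [scale, NNReal.coe_rpow, ← Real.rpow_mul t.coe_nonneg]
  congr 1
  ring

/-- This balance fixes the exponent 1/(2+β): confining Y and keeping X in D then have costs of the
same order. -/
lemma div_scale_sq (hβ : 0 < β) {t : ℝ≥0} (ht : t ≠ 0) :
    (t : ℝ) / (scale β t : ℝ) ^ 2 = (scale β t : ℝ) ^ β := by
  have ht' : (0 : ℝ) < t := by positivity
  rw [scale_rpow, scale, NNReal.coe_rpow, ← Real.rpow_natCast, ← Real.rpow_mul ht'.le,
    div_eq_iff (by positivity), ← Real.rpow_add ht']
  rw [show β / (2 + β) + 1 / (2 + β) * (2 : ℕ) = 1 by push_cast; field_simp; ring, Real.rpow_one]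

lemma eventually_exp_le_measureReal_lt_exitTime (hβ0 : 0 < β) (hc : 0 < c) (hD : IsOpen D)
    (hp0 : ∀ s, 0 ≤ p s)
    (hp : Tendsto (fun t : ℝ≥0 => (t : ℝ) ^ (-β) * Real.log (p t)) atTop (𝓝 (-c)))
    (hpp : ∀ s, P.real (stay Xp z D s) = p s) (hpm : ∀ s, P.real (stay Xm z D s) = p s)
    (hXp : IsBrownian Xp P) (hXm : IsBrownian Xm P) (hY : IsBrownianReal Y P)
    (hXX : IndepFun (fun (ω : Ω) (t : ℝ≥0) => Xp t ω) (fun (ω : Ω) (t : ℝ≥0) => Xm t ω) P)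
    (hXY : IndepFun (fun ω : Ω => ((fun t : ℝ≥0 => Xp t ω), (fun t : ℝ≥0 => Xm t ω)))
      (fun (ω : Ω) (t : ℝ≥0) => Y t ω) P) {ε : ℝ} (hε : 0 < ε) :
    ∀ᶠ t : ℝ≥0 in atTop, Real.exp (-((rate β c + ε) * (scale β t : ℝ) ^ β)) ≤
      P.real {ω | (t : WithTop ℝ≥0) < exitTime (iterated z Xp Xm Y) D ω} := by
  obtain ⟨K, hK, hV⟩ := exists_rate_eq' hβ0 hc
  lift K to ℝ≥0 using hK.le
  have hK0 : K ≠ 0 := by rintro rfl; simp at hK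
  -- The short side must have positive length, or the sine prefactor σ would vanish. Its cost ε/4
  -- and two errors ε/8 use up ε/2; the other ε/2 absorbs σ.
  obtain ⟨δ, hδ0, hδ⟩ := exists_pos_mul_rpow_eq hβ0 hc (show 0 < ε / 4 by positivity)
  have hδ' : (0 : ℝ) < δ := by positivity
  set σ := Real.sin (Real.pi * δ / (δ + K)) with hσ
  have hσ0 : 0 < σ := by
    refine Real.sin_pos_of_pos_of_lt_pi (by positivity) ?_
    rw [div_lt_iff₀ (by positivity)]
    nlinarith [Real.pi_pos]
  filter_upwards [eventually_exp_le hp0 hc hp (tendsto_scale hβ0) hK0 (show 0 < ε / 8 by positivity),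
    eventually_exp_le hp0 hc hp (tendsto_scale hβ0) hδ0 (show 0 < ε / 8 by positivity),
    eventually_exp_le_mul_exp (tendsto_scale_rpow hβ0) hσ0
      (show rate β c + ε / 2 < rate β c + ε by linarith),
    eventually_gt_atTop 0, (tendsto_scale hβ0).eventually_gt_atTop 0] with t h1 h2 h3 ht hx
  have hx' : (0 : ℝ) < scale β t := by exact_mod_cast hx
  have h4 := le_measureReal_lt_exitTime_iterated z hXp hXm hY hXX hXY hD t (δ * scale β t)
    (K * scale β t)
  rw [hpp, hpm] at h4
  have h5 := le_measureReal_forall_mem_Icc hY ht.ne' (a := ((δ * scale β t : ℝ≥0) : ℝ))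
    (b := ((K * scale β t : ℝ≥0) : ℝ)) (by positivity) (by positivity) (by positivity)
  have h6 : Real.sin (Real.pi * ((δ * scale β t : ℝ≥0) : ℝ) /
      (((δ * scale β t : ℝ≥0) : ℝ) + ((K * scale β t : ℝ≥0) : ℝ))) = σ := by
    rw [hσ]
    push_cast
    congr 1
    field_simp
  rw [h6] at h5
  set S := (scale β t : ℝ) ^ β with hS
  -- The interval has length (δ + K)x ≥ Kx, so confinement is no costlier than for length Kx.
  have h7 : Real.pi ^ 2 / (2 * (((δ * scale β t : ℝ≥0) : ℝ) + ((K * scale β t : ℝ≥0) : ℝ)) ^ 2) * t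
      ≤ Real.pi ^ 2 / (2 * (K : ℝ) ^ 2) * S := by
    rw [hS, ← div_scale_sq hβ0 ht.ne', div_mul_div_comm, div_mul_eq_mul_div]
    refine div_le_div_of_nonneg_left (by positivity) (by positivity) ?_
    rw [mul_assoc, ← mul_pow]
    push_cast
    gcongr
    have : (0 : ℝ) ≤ δ * scale β t := by positivity
    linarith
  refine h3.trans (le_trans ?_ h4)
  calc σ * Real.exp (-((rate β c + ε / 2) * S))
      = Real.exp (-((c * (K : ℝ) ^ β + ε / 8) * S)) * Real.exp (-((c * (δ : ℝ) ^ β + ε / 8) * S)) *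
        (σ * Real.exp (-(Real.pi ^ 2 / (2 * (K : ℝ) ^ 2) * S))) := by
        rw [mul_left_comm, ← Real.exp_add, ← Real.exp_add, hδ, hV]
        ring_nf
    _ ≤ p (K * scale β t) * p (δ * scale β t) * _ := by
        refine mul_le_mul (mul_le_mul h1 h2 (Real.exp_pos _).le (hp0 _)) (le_trans ?_ h5)
          (by positivity) (mul_nonneg (hp0 _) (hp0 _))
        gcongr

lemma eventually_measureReal_lt_exitTime_le (hβ0 : 0 < β) (hβ1 : β ≤ 1) (hc : 0 < c)
    (hD : IsOpen D) (hp0 : ∀ s, 0 ≤ p s) (hp1 : ∀ s, p s ≤ 1)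
    (hp : Tendsto (fun t : ℝ≥0 => (t : ℝ) ^ (-β) * Real.log (p t)) atTop (𝓝 (-c)))
    (hpp : ∀ s, P.real (stay Xp z D s) = p s) (hpm : ∀ s, P.real (stay Xm z D s) = p s)
    (hXp : IsBrownian Xp P) (hXm : IsBrownian Xm P) (hY : IsBrownianReal Y P)
    (hXX : IndepFun (fun (ω : Ω) (t : ℝ≥0) => Xp t ω) (fun (ω : Ω) (t : ℝ≥0) => Xm t ω) P)
    (hXY : IndepFun (fun ω : Ω => ((fun t : ℝ≥0 => Xp t ω), (fun t : ℝ≥0 => Xm t ω)))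
      (fun (ω : Ω) (t : ℝ≥0) => Y t ω) P) {ε : ℝ} (hε : 0 < ε) :
    ∀ᶠ t : ℝ≥0 in atTop, P.real {ω | (t : WithTop ℝ≥0) < exitTime (iterated z Xp Xm Y) D ω} ≤
      Real.exp (-((rate β c - ε) * (scale β t : ℝ) ^ β)) := by
  set V := rate β c with hV
  have hV0 : 0 < V := by rw [hV, rate]; positivity
  -- One e for each of the three exponential estimates in a cell, one for the grid rounding, and one
  -- for the multiplicative constants.
  set e := ε / 5 with he
  have he0 : 0 < e := by positivity
  -- δ₂ = 2δ is the length gained by rounding both ends of the interval up, and c δ₂^β = e is its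
  -- cost.
  obtain ⟨δ₂, hδ₂0, hδ₂⟩ := exists_pos_mul_rpow_eq hβ0 hc he0
  set δ := δ₂ / 2 with hδ
  have hδ0 : δ ≠ 0 := by positivity
  have hδ' : (0 : ℝ) < δ := by positivity
  have hδδ : (δ₂ : ℝ) = 2 * δ := by rw [hδ]; push_cast; ring
  -- Beyond length R x a single side already costs V, so a grid with Nδ ≥ R suffices and N does not
  -- depend on t.
  obtain ⟨R, -, hR⟩ := exists_pos_mul_rpow_eq hβ0 hc hV0
  obtain ⟨N, hN⟩ := exists_nat_ge ((R : ℝ) / δ)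
  rw [div_le_iff₀ hδ'] at hN
  have hNV : V ≤ c * (((N * δ : ℝ≥0) : ℝ)) ^ β := by
    rw [← hR]
    push_cast
    gcongr
  have hC : ∀ q : ℕ × ℕ, ∃ C : ℝ, 0 < C ∧ ∀ t x : ℝ≥0, x ≠ 0 →
      P.real {ω | ∀ s ≤ t, Y s ω ∈ Set.Icc (-((q.2 + 1) * δ * x) : ℝ) ((q.1 + 1) * δ * x)} ≤
        C * Real.exp (-((Real.pi ^ 2 / (2 * ((q.2 + 1) * δ + (q.1 + 1) * δ : ℝ) ^ 2) - e) *
          (t / x ^ 2))) := fun q => by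
    obtain ⟨C, hC0, hC⟩ := exists_forall_measureReal_scaled_le
      (a := (q.2 + 1) * δ) (b := (q.1 + 1) * δ) (by positivity) (by positivity) (by positivity)
      (sub_lt_self (Real.pi ^ 2 / (2 * ((q.2 + 1) * δ + (q.1 + 1) * δ : ℝ) ^ 2)) he0)
    exact ⟨C, hC0, fun t x hx => hC P Y hY.toIsPreBrownianReal t x hx⟩
  choose C hC0 hC using hC
  have hall : ∀ᶠ t in atTop, ∀ i ∈ Finset.range N, p ((i * δ : ℝ≥0) * scale β t) ≤
      Real.exp (-((c * ((i * δ : ℝ≥0) : ℝ) ^ β - e) * (scale β t : ℝ) ^ β)) :=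
    (Filter.eventually_all_finset _).2 fun i _ =>
      eventually_le_exp hβ0 hp1 hp (tendsto_scale hβ0) _ he0
  filter_upwards [hall, eventually_le_exp hβ0 hp1 hp (tendsto_scale hβ0) (N * δ) he0,
    eventually_mul_exp_le (tendsto_scale_rpow hβ0)
      (2 + ∑ q ∈ Finset.range N ×ˢ Finset.range N, C q) (show V - ε < V - 4 * e by linarith),
    eventually_gt_atTop 0, (tendsto_scale hβ0).eventually_gt_atTop 0] with t h1 h2 h3 ht hx
  have h4 := measureReal_lt_exitTime_iterated_le z hXp hXm hY hXX hXY hD t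
    (d := δ * scale β t) (mul_ne_zero hδ0 hx.ne') N
  simp only [hpp, hpm, ← mul_assoc] at h4
  refine h4.trans (le_trans ?_ h3)
  set S := (scale β t : ℝ) ^ β with hS
  have hS0 : 0 ≤ S := by positivity
  have h5 : p (N * δ * scale β t) ≤ Real.exp (-((V - 4 * e) * S)) := by
    refine h2.trans (Real.exp_le_exp.2 (neg_le_neg ?_))
    gcongr ?_ * _
    linarith
  rw [add_mul, Finset.sum_mul, two_mul]
  refine add_le_add (add_le_add h5 h5) (Finset.sum_le_sum fun q hq => ?_)
  rw [Finset.mem_product] at hq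
  have h6 := h1 _ hq.1
  have h7 := h1 _ hq.2
  have h8 := hC q t (scale β t) hx.ne'
  rw [div_scale_sq hβ0 ht.ne', ← hS] at h8
  -- `rate_le` is applied to the full length of the interval; subadditivity of u ↦ u^β, where β ≤ 1
  -- enters, then splits that length into the two rounded sides and δ₂.
  have h9 : V - 4 * e ≤ (c * ((q.1 * δ : ℝ≥0) : ℝ) ^ β - e) + (c * ((q.2 * δ : ℝ≥0) : ℝ) ^ β - e) +
      (Real.pi ^ 2 / (2 * ((q.2 + 1) * δ + (q.1 + 1) * δ : ℝ) ^ 2) - e) := by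
    have h10 := rate_le hβ0 hc (show (0 : ℝ) < (q.2 + 1) * δ + (q.1 + 1) * δ by positivity)
    have h11 := rpow_add_add_le hβ0 hβ1 (u := ((q.1 * δ : ℝ≥0) : ℝ)) (v := ((q.2 * δ : ℝ≥0) : ℝ))
      (w := δ₂) (by positivity) (by positivity) (by positivity)
    rw [show ((q.1 * δ : ℝ≥0) : ℝ) + ((q.2 * δ : ℝ≥0) : ℝ) + δ₂ =
      (q.2 + 1) * δ + (q.1 + 1) * δ by rw [hδδ]; push_cast; ring] at h11
    have h12 := mul_le_mul_of_nonneg_left h11 hc.le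
    rw [mul_add, mul_add, hδ₂] at h12
    linarith
  push_cast
  simp only [← mul_assoc]
  calc _ ≤ Real.exp (-((c * ((q.1 * δ : ℝ≥0) : ℝ) ^ β - e) * S)) *
        Real.exp (-((c * ((q.2 * δ : ℝ≥0) : ℝ) ^ β - e) * S)) *
        (C q * Real.exp (-((Real.pi ^ 2 / (2 * ((q.2 + 1) * δ + (q.1 + 1) * δ : ℝ) ^ 2) - e) *
          S))) :=
        mul_le_mul (mul_le_mul h6 h7 (hp0 _) (Real.exp_pos _).le) h8 measureReal_nonneg
          (by positivity)
    _ = C q * Real.exp (-(((c * ((q.1 * δ : ℝ≥0) : ℝ) ^ β - e) +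
          (c * ((q.2 * δ : ℝ≥0) : ℝ) ^ β - e) +
          (Real.pi ^ 2 / (2 * ((q.2 + 1) * δ + (q.1 + 1) * δ : ℝ) ^ 2) - e)) * S)) := by
        rw [mul_left_comm, ← Real.exp_add, ← Real.exp_add]
        congr 2
        ring
    _ ≤ C q * Real.exp (-((V - 4 * e) * S)) := by
        have := hC0 q
        gcongr

end Main

end IteratedBM

theorem theorem3p2 {n : ℕ} (β c : ℝ) (hβ0 : 0 < β) (hβ1 : β ≤ 1) (hc : 0 < c)
    (D : Set (EuclideanSpace ℝ (Fin n))) (hDo : IsOpen D) (hDc : IsConnected D)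
    (z : EuclideanSpace ℝ (Fin n)) (hz : z ∈ D)
    -- a Brownian motion `z + W` started at `z`, and the hypothesis on its exit time from `D`
    {Ω' : Type*} [MeasurableSpace Ω'] (P' : Measure Ω') [IsProbabilityMeasure P']
    (W : ℝ≥0 → Ω' → EuclideanSpace ℝ (Fin n)) (hW : IteratedBM.IsBrownian W P')
    (hτ : Tendsto
      (fun t : ℝ≥0 => (t : ℝ) ^ (-β) *
        Real.log (P'.real {ω | (t : WithTop ℝ≥0) <
          IteratedBM.exitTime (fun s ω => z + W s ω) D ω}))
      atTop (𝓝 (-c)))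
    -- the three independent Brownian motions that drive the iterated Brownian motion
    {Ω : Type*} [MeasurableSpace Ω] (P : Measure Ω) [IsProbabilityMeasure P]
    (Xp Xm : ℝ≥0 → Ω → EuclideanSpace ℝ (Fin n)) (Y : ℝ≥0 → Ω → ℝ)
    (hXp : IteratedBM.IsBrownian Xp P) (hXm : IteratedBM.IsBrownian Xm P)
    (hY : IsBrownianReal Y P)
    (hXX : IndepFun (fun (ω : Ω) (t : ℝ≥0) => Xp t ω) (fun (ω : Ω) (t : ℝ≥0) => Xm t ω) P)
    (hXY : IndepFun (fun ω : Ω => ((fun t : ℝ≥0 => Xp t ω), (fun t : ℝ≥0 => Xm t ω)))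
      (fun (ω : Ω) (t : ℝ≥0) => Y t ω) P) :
    Tendsto
      (fun t : ℝ≥0 => (t : ℝ) ^ (-(β / (2 + β))) *
        Real.log (P.real {ω | (t : WithTop ℝ≥0) <
          IteratedBM.exitTime (IteratedBM.iterated z Xp Xm Y) D ω}))
      atTop
      (𝓝 (-((2 + β) / 2 * c ^ (2 / (2 + β)) * β ^ (-(β / (2 + β))) *
        Real.pi ^ (2 * β / (2 + β))))) := by

  have hp : ∀ {Ω₁ : Type _} [MeasurableSpace Ω₁] {P₁ : Measure Ω₁} [IsProbabilityMeasure P₁]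
      {B : ℝ≥0 → Ω₁ → EuclideanSpace ℝ (Fin n)}, IteratedBM.IsBrownian B P₁ → ∀ s,
      P₁.real (IteratedBM.stay B z D s) = P'.real (IteratedBM.stay W z D s) := fun hB s => by
    rw [measureReal_def, IteratedBM.measure_stay_eq hB hW z hDo s, measureReal_def]
  simp_rw [fun t => measureReal_congr (IteratedBM.setOf_lt_exitTime_ae_eq hW z hDo t)] at hτ
  have key := IteratedBM.tendsto_inv_mul_log (IteratedBM.tendsto_scale_rpow hβ0)
    (V := IteratedBM.rate β c)
    (fun ε hε => IteratedBM.eventually_exp_le_measureReal_lt_exitTime hβ0 hc hDo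
      (fun _ => measureReal_nonneg) hτ (hp hXp) (hp hXm) hXp hXm hY hXX hXY hε)
    (fun ε hε => IteratedBM.eventually_measureReal_lt_exitTime_le hβ0 hβ1 hc hDo
      (fun _ => measureReal_nonneg) (fun _ => measureReal_le_one) hτ (hp hXp) (hp hXm)
      hXp hXm hY hXX hXY hε)
  refine key.congr fun t => ?_
  rw [IteratedBM.scale_rpow, Real.rpow_neg t.coe_nonneg]
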